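/- Consider quantum circuits built from arbitrary one-qubit gates, CNOT gates and unbounded fan-out gates $|y\rangle\bigotimes_{j=0}^{k-1}|x_j\rangle\mapsto|y\rangle\bigotimes_{j=0}^{k-1}|x_j\oplus y\rangle$ ($k\ge 1$), with any finite number of ancillary qubits that start in $|0\rangle$ and are returned to $|0\rangle$. The size of a circuit is the total number of qubits affected by its gates, summed over all gates; the depth of a gate is $1$ plus the maximal depth of a gate on which it depends (input qubits have depth $0$), and the depth of a circuit is the maximal depth of its gates. For $1\le t\le n$ and $x\in\{0,1\}^n$ let $\mathrm{TH}_n^t(x)=1$ if $|x|\ge t$ and $0$ otherwise, where $|x|$ is the Hamming weight of $x$; a circuit is a circuit for $\mathrm{TH}_n^t$ if it implements exactly the quantum operation $|x\rangle|z\rangle\mapsto|x\rangle|z\oplus \mathrm{TH}_n^t(x)\rangle$ ($x\in\{0,1\}^n$, $z\in\{0,1\}$). Let $\log$ denote the logarithm to base $2$. **Theorem 2.** There are absolute constants $D$ and $K$ such that for all integers $n\ge 2$ and $1\le t\le n$: - if $t\le\log n$ or $t\ge n-\log n$, there is a circuit for $\mathrm{TH}_n^t$ of depth at most $D$ and size at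 most $K\,n\log n$; - if $\log n\le t\le\lceil n/2\rceil$, there is a circuit for $\mathrm{TH}_n^t$ of depth at most $D$ and size at most $K\,n\sqrt{t\log n}$; - if $\lceil n/2\rceil\le t\le n-\log n$, there is a circuit for $\mathrm{TH}_n^t$ of depth at most $D$ and size at most $K\,n\sqrt{(n-t)\log n}$. -/

import Mathlib

/-- The elementary gates on a collection `W` of qubits: an arbitrary one-qubit unitary `U` applied to
the qubit `w`, and the unbounded fan-out gate on `k + 1` qubits (`k ≥ 1`) with one control qubit and
a set of `k` target qubits. The fan-out gate with a single target is the CNOT gate. -/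
inductive QGate (W : Type) : Type where
  | oneQubit (w : W) (U : Matrix.unitaryGroup Bool ℂ) : QGate W
  | fanOut (control : W) (targets : Finset W) (hne : targets.Nonempty)
      (hnot : control ∉ targets) : QGate W

/-- Pure (not necessarily normalized) states of the qubits in `W`: the amplitude of every
computational basis vector. -/
abbrev QState (W : Type) : Type := (W → Bool) → ℂ

namespace QGate

variable {W : Type} [DecidableEq W]

/-- The set of qubits affected by a gate. -/
def qubits : QGate W → Finset W
  | oneQubit w _ => {w}
  | fanOut c T _ _ => insert c T

/-- The permutation of basis labels performed by a fan-out gate: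
`x_j ↦ x_j ⊕ x_c` for the targets `j`, all the other bits are unchanged. -/
def fanOutMap (c : W) (T : Finset W) (x : W → Bool) : W → Bool :=
  fun j => if j ∈ T then xor (x j) (x c) else x j

/-- The linear operator implemented by a gate. The fan-out gate sends the basis vector of `x` to
that of `fanOutMap c T x`; as `fanOutMap c T` is an involution, on amplitudes this is
precomposition with it. -/
noncomputable def op : QGate W → (QState W →ₗ[ℂ] QState W)
  | oneQubit w U =>
    { toFun := fun ψ x => ∑ b : Bool, (U : Matrix Bool Bool ℂ) (x w) b * ψ (Function.update x w b)
      map_add' := by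
        intro φ ψ; funext x; simp only [Pi.add_apply, mul_add, Finset.sum_add_distrib]
      map_smul' := by
        intro a ψ; funext x
        simp only [Pi.smul_apply, smul_eq_mul, RingHom.id_apply, Finset.mul_sum]
        exact Finset.sum_congr rfl fun b _ => by ring }
  | fanOut c T _ _ =>
    { toFun := fun ψ x => ψ (fanOutMap c T x)
      map_add' := fun _ _ => rfl
      map_smul' := fun _ _ => rfl }

/-- The depth of a gate, given for every qubit the depth `d` of the last gate that acted on it
(`0` for an input): one plus the maximal depth of a gate on which it depends. -/
def depthAt (d : W → ℕ) (g : QGate W) : ℕ := 1 + g.qubits.sup d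

end QGate

/-- The computational basis vector `|x⟩`. -/
noncomputable def ket {W : Type} [DecidableEq (W → Bool)] (x : W → Bool) : QState W :=
  Pi.single x 1

/-- The maximal depth of a gate in a sequence of gates (applied from left to right), where `d w` is
the depth of the last gate that has acted on the qubit `w` before the sequence. -/
def gatesDepth {W : Type} [DecidableEq W] : (W → ℕ) → List (QGate W) → ℕ
  | _, [] => 0
  | d, g :: gs =>
    max (g.depthAt d) (gatesDepth (fun w => if w ∈ g.qubits then g.depthAt d else d w) gs)

/-- The operator implemented by a sequence of gates, the head of the list being applied first. -/
noncomputable def gatesOp {W : Type} [DecidableEq W] :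
    List (QGate W) → (QState W →ₗ[ℂ] QState W)
  | [] => LinearMap.id
  | g :: gs => (gatesOp gs).comp g.op

/-- A quantum circuit on `n` input qubits, one output qubit and a finite set of ancillary qubits:
a finite sequence of elementary gates. -/
structure QCircuit (n : ℕ) where
  Anc : Type
  [fintypeAnc : Fintype Anc]
  [decEqAnc : DecidableEq Anc]
  gates : List (QGate (Fin n ⊕ Unit ⊕ Anc))

namespace QCircuit

attribute [instance] QCircuit.fintypeAnc QCircuit.decEqAnc

variable {n : ℕ}

/-- The size of a circuit: the total size of its gates, the size of a gate being the number of
qubits affected by it. -/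
def size (C : QCircuit n) : ℕ := (C.gates.map fun g => g.qubits.card).sum

/-- The depth of a circuit: the maximal depth of a gate in it; input qubits have depth `0`. -/
def depth (C : QCircuit n) : ℕ := gatesDepth (fun _ => 0) C.gates

/-- The bit string in which the input register holds `x`, the output qubit holds `z` and all
ancillary qubits hold `0`. -/
def label (C : QCircuit n) (x : Fin n → Bool) (z : Bool) : Fin n ⊕ Unit ⊕ C.Anc → Bool :=
  Sum.elim x (Sum.elim (fun _ => z) (fun _ => false))

/-- The circuit implements exactly the quantum operation `|x⟩|z⟩ ↦ |x⟩|z ⊕ f x⟩`, with ancillary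
qubits that are initialized to `|0⟩` (and are returned to `|0⟩`). -/
def Computes (C : QCircuit n) (f : (Fin n → Bool) → Bool) : Prop :=
  ∀ (x : Fin n → Bool) (z : Bool),
    gatesOp C.gates (ket (C.label x z)) = ket (C.label x (xor z (f x)))

end QCircuit

/-- The Hamming weight of a bit string. -/
def hammingWt {n : ℕ} (x : Fin n → Bool) : ℕ := (Finset.univ.filter fun j => x j = true).card

/-- The threshold function on `n` bits with threshold `t`. -/
def thresholdFn (n t : ℕ) (x : Fin n → Bool) : Bool := decide (t ≤ hammingWt x)

set_option linter.unusedSectionVars false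

/-- The unit complex number `exp (i π θ)`. -/
noncomputable def phase (θ : ℝ) : ℂ := Complex.exp (Real.pi * θ * Complex.I)

theorem phase_add (a b : ℝ) : phase (a + b) = phase a * phase b := by
  rw [phase, phase, phase, ← Complex.exp_add]; push_cast; ring_nf

theorem phase_zero : phase 0 = 1 := by simp [phase]

theorem phase_one : phase 1 = -1 := by simp [phase]

theorem phase_sum {ι : Type*} (s : Finset ι) (f : ι → ℝ) :
    phase (∑ i ∈ s, f i) = ∏ i ∈ s, phase (f i) := by
  classical
  induction s using Finset.induction_on with
  | empty => simp [phase_zero]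
  | insert a s ha ih => rw [Finset.sum_insert ha, Finset.prod_insert ha, phase_add, ih]

theorem phase_mul_neg (θ : ℝ) : phase θ * phase (-θ) = 1 := by
  rw [← phase_add, add_neg_cancel, phase_zero]

theorem phase_neg_mul (θ : ℝ) : phase (-θ) * phase θ = 1 := by
  rw [← phase_add, neg_add_cancel, phase_zero]

theorem star_phase (θ : ℝ) : star (phase θ) = phase (-θ) := by
  simp only [phase, Complex.star_def, ← Complex.exp_conj]
  simp

theorem phase_int_even (k : ℤ) : phase (2 * k) = 1 := by
  rw [phase, Complex.exp_eq_one_iff]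
  exact ⟨k, by push_cast; ring⟩

theorem phase_int_odd (k : ℤ) : phase (2 * k + 1) = -1 := by
  rw [phase_add, phase_int_even, phase_one, one_mul]

/-- The one-qubit gate with matrix `diag (1, exp (i π θ))`. -/
noncomputable def phaseGate (θ : ℝ) : Matrix.unitaryGroup Bool ℂ :=
  ⟨Matrix.diagonal fun b => if b then phase θ else 1, by
    rw [Matrix.mem_unitaryGroup_iff, Matrix.star_eq_conjTranspose, Matrix.diagonal_conjTranspose,
      Matrix.diagonal_mul_diagonal, ← Matrix.diagonal_one]
    congr 1
    funext b
    cases b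
    · simp
    · simp only [Pi.star_apply, if_true, star_phase, phase_mul_neg]⟩

/-- The Hadamard gate. -/
noncomputable def hadamardGate : Matrix.unitaryGroup Bool ℂ :=
  ⟨Matrix.of fun a b => ((√2)⁻¹ : ℂ) * if a && b then -1 else 1, by
    have h2 : ((√2 : ℝ) : ℂ)⁻¹ * ((√2 : ℝ) : ℂ)⁻¹ = 1 / 2 := by
      rw [← mul_inv, ← Complex.ofReal_mul, Real.mul_self_sqrt (by norm_num)]; norm_num
    rw [Matrix.mem_unitaryGroup_iff]
    ext a b
    rw [Matrix.mul_apply, Fintype.sum_bool, Matrix.star_apply, Matrix.star_apply]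
    cases a <;> cases b <;> simp [h2] <;> norm_num⟩

section GateSequences

variable {W : Type} [DecidableEq W]

theorem gatesOp_append (l₁ l₂ : List (QGate W)) :
    gatesOp (l₁ ++ l₂) = (gatesOp l₂).comp (gatesOp l₁) := by
  induction l₁ with
  | nil => simp [gatesOp]
  | cons g gs ih => simp [gatesOp, ih, LinearMap.comp_assoc]

/-- Flipping the bit of the qubit `p`. -/
def flipBit (p : W) (v : W → Bool) : W → Bool := Function.update v p (!v p)

@[simp] theorem flipBit_self (p : W) (v : W → Bool) : flipBit p v p = !v p := by simp [flipBit]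

theorem flipBit_of_ne {p w : W} (h : w ≠ p) (v : W → Bool) : flipBit p v w = v w := by
  simp [flipBit, h]

@[simp] theorem flipBit_flipBit (p : W) (v : W → Bool) : flipBit p (flipBit p v) = v := by
  simp [flipBit]

theorem flipBit_comm (p q : W) (v : W → Bool) :
    flipBit p (flipBit q v) = flipBit q (flipBit p v) := by
  funext w
  by_cases hp : w = p <;> by_cases hq : w = q <;> simp_all [flipBit, Function.update_apply]

/-- The operator that acts on the qubit `p` as `H diag (1, u) H`, where `u` may depend on the
other qubits. -/
noncomputable def rot (p : W) (u : (W → Bool) → ℂ) : QState W →ₗ[ℂ] QState W where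
  toFun ψ v := (1 + u v) / 2 * ψ v + (1 - u v) / 2 * ψ (flipBit p v)
  map_add' φ ψ := by funext v; simp only [Pi.add_apply]; ring
  map_smul' a ψ := by funext v; simp only [Pi.smul_apply, smul_eq_mul, RingHom.id_apply]; ring

theorem rot_apply (p : W) (u : (W → Bool) → ℂ) (ψ : QState W) (v : W → Bool) :
    rot p u ψ v = (1 + u v) / 2 * ψ v + (1 - u v) / 2 * ψ (flipBit p v) := rfl

theorem rot_comp_rot {p : W} {u u' : (W → Bool) → ℂ} (hu' : ∀ v, u' (flipBit p v) = u' v)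
    (h : ∀ v, u v * u' v = 1) : (rot p u).comp (rot p u') = LinearMap.id := by
  ext1 ψ; funext v
  simp only [LinearMap.comp_apply, rot_apply, flipBit_flipBit, hu', LinearMap.id_apply]
  linear_combination (ψ v - ψ (flipBit p v)) / 2 * h v

theorem op_phaseGate (w : W) (θ : ℝ) (ψ : QState W) (v : W → Bool) :
    (QGate.oneQubit w (phaseGate θ)).op ψ v = (if v w then phase θ else 1) * ψ v := by
  have : ∀ b, v w = b → Function.update v w b = v := by rintro b rfl; simp
  change ∑ b : Bool, Matrix.diagonal (fun b => if b then phase θ else 1) (v w) b *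
    ψ (Function.update v w b) = _
  rw [Fintype.sum_bool]
  cases h : v w <;> simp [this _ h]

theorem op_hadamardGate (w : W) (ψ : QState W) (v : W → Bool) :
    (QGate.oneQubit w hadamardGate).op ψ v =
      ((√2 : ℝ) : ℂ)⁻¹ * ((if v w then -1 else 1) * ψ v + ψ (flipBit w v)) := by
  have : ∀ b, v w = b → Function.update v w b = v := by rintro b rfl; simp
  change ∑ b : Bool, ((√2 : ℝ) : ℂ)⁻¹ * (if v w && b then -1 else 1) *
    ψ (Function.update v w b) = _
  rw [Fintype.sum_bool]
  cases h : v w <;> simp [this _ h, flipBit, h] <;> ring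

theorem gatesOp_phaseGates (C : List W) (θ : W → ℝ) (ψ : QState W) (v : W → Bool) :
    gatesOp (C.map fun c => QGate.oneQubit c (phaseGate (θ c))) ψ v =
      (C.map fun c => if v c then phase (θ c) else 1).prod * ψ v := by
  induction C generalizing ψ with
  | nil => simp [gatesOp]
  | cons c C ih =>
    simp only [List.map_cons, gatesOp, LinearMap.comp_apply, ih, op_phaseGate, List.prod_cons]
    ring

/-- The fan-out gate, or no gate at all if it has no target. -/
def fan (p : W) (T : Finset W) : List (QGate W) :=
  if h : T.Nonempty ∧ p ∉ T then [QGate.fanOut p T h.1 h.2] else []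

theorem gatesOp_fan {p : W} {T : Finset W} (hp : p ∉ T) (ψ : QState W) (v : W → Bool) :
    gatesOp (fan p T) ψ v = ψ (QGate.fanOutMap p T v) := by
  by_cases h : T.Nonempty
  · rw [fan, dif_pos ⟨h, hp⟩]; rfl
  · rw [fan, dif_neg (fun h' => h h'.1)]
    rw [Finset.not_nonempty_iff_eq_empty] at h
    subst h
    congr 1

theorem fanOutMap_fanOutMap {p : W} {T : Finset W} (hp : p ∉ T) (v : W → Bool) :
    QGate.fanOutMap p T (QGate.fanOutMap p T v) = v := by
  funext w
  by_cases h : w ∈ T <;> simp [QGate.fanOutMap, h, hp]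

/-- A constant-depth circuit for `rot p u`, where the argument of `u` is a weighted sum of the bits
in `C`. -/
noncomputable def block (p : W) (C : Finset W) (θ : W → ℝ) (θ₀ : ℝ) : List (QGate W) :=
  [QGate.oneQubit p hadamardGate] ++
  ((C.toList.map fun c => QGate.oneQubit c (phaseGate (θ c / 2))) ++
  (fan p C ++
  ((C.toList.map fun c => QGate.oneQubit c (phaseGate (-(θ c / 2)))) ++
  (fan p C ++
  ([QGate.oneQubit p (phaseGate (θ₀ + ∑ c ∈ C, θ c / 2))] ++
  [QGate.oneQubit p hadamardGate])))))

theorem gatesOp_block {p : W} {C : Finset W} (hp : p ∉ C) (θ : W → ℝ) (θ₀ : ℝ) :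
    gatesOp (block p C θ θ₀) =
      rot p fun v => phase (θ₀ + ∑ c ∈ C, if v c then θ c else 0) := by
  ext1 ψ
  set u : (W → Bool) → ℂ := fun v => phase (θ₀ + ∑ c ∈ C, if v c then θ c else 0) with hu
  have hmid : ∀ (φ : QState W) v, gatesOp ((C.toList.map fun c =>
        QGate.oneQubit c (phaseGate (θ c / 2))) ++ (fan p C ++
        ((C.toList.map fun c => QGate.oneQubit c (phaseGate (-(θ c / 2)))) ++ (fan p C ++
        [QGate.oneQubit p (phaseGate (θ₀ + ∑ c ∈ C, θ c / 2))])))) φ v =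
      (if v p then u v else 1) * φ v := by
    intro φ v
    simp only [gatesOp_append, LinearMap.comp_apply, gatesOp, LinearMap.id_apply, op_phaseGate,
      gatesOp_fan hp, gatesOp_phaseGates, fanOutMap_fanOutMap hp, Finset.prod_map_toList]
    rw [← mul_assoc, ← mul_assoc]
    congr 1
    cases hvp : v p
    · rw [if_neg (by simp), if_neg (by simp), one_mul, ← Finset.prod_mul_distrib]
      refine Finset.prod_eq_one fun c hc => ?_
      simp only [QGate.fanOutMap, hc, if_true, hvp, Bool.xor_false]
      cases v c <;> simp [phase_neg_mul]
    · rw [if_pos rfl, if_pos rfl, hu]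
      simp only [phase_add, mul_assoc]
      congr 1
      rw [phase_sum, phase_sum, ← Finset.prod_mul_distrib, ← Finset.prod_mul_distrib]
      refine Finset.prod_congr rfl fun c hc => ?_
      simp only [QGate.fanOutMap, hc, if_true, hvp, Bool.xor_true]
      cases v c
      · simp [phase_mul_neg, phase_zero]
      · simp [← phase_add]
  have huf : ∀ v, u (flipBit p v) = u v := by
    intro v
    simp only [hu]
    congr 2
    refine Finset.sum_congr rfl fun c hc => ?_
    rw [flipBit_of_ne (by rintro rfl; exact hp hc)]
  have h2 : ((√2 : ℝ) : ℂ)⁻¹ * ((√2 : ℝ) : ℂ)⁻¹ = 1 / 2 := by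
    rw [← mul_inv, ← Complex.ofReal_mul, Real.mul_self_sqrt (by norm_num)]; norm_num
  funext v
  have hb : block p C θ θ₀ = [QGate.oneQubit p hadamardGate] ++ (((C.toList.map fun c =>
        QGate.oneQubit c (phaseGate (θ c / 2))) ++ (fan p C ++
        ((C.toList.map fun c => QGate.oneQubit c (phaseGate (-(θ c / 2)))) ++ (fan p C ++
        [QGate.oneQubit p (phaseGate (θ₀ + ∑ c ∈ C, θ c / 2))])))) ++
        [QGate.oneQubit p hadamardGate]) := by
    simp [block, List.append_assoc]
  rw [hb, gatesOp_append, gatesOp_append, rot_apply]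
  simp only [LinearMap.comp_apply]
  have hH : ∀ (φ : QState W) v, gatesOp [QGate.oneQubit p hadamardGate] φ v =
      ((√2 : ℝ) : ℂ)⁻¹ * ((if v p then -1 else 1) * φ v + φ (flipBit p v)) :=
    fun φ v => op_hadamardGate p φ v
  rw [hH, hmid, hmid, hH, hH, flipBit_flipBit, flipBit_self, huf]
  cases v p
  · simp only [Bool.false_eq_true, if_false, Bool.not_false, if_true]
    linear_combination ((1 + u v) * ψ v + (1 - u v) * ψ (flipBit p v)) * h2
  · simp only [Bool.false_eq_true, if_false, Bool.not_true, if_true]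
    linear_combination ((1 + u v) * ψ v + (1 - u v) * ψ (flipBit p v)) * h2

/-- The depth of the last gate acting on each qubit after a sequence of gates. -/
def depthAfter : (W → ℕ) → List (QGate W) → W → ℕ
  | d, [] => d
  | d, g :: gs => depthAfter (fun w => if w ∈ g.qubits then g.depthAt d else d w) gs

theorem depthAfter_append (d : W → ℕ) (l₁ l₂ : List (QGate W)) :
    depthAfter d (l₁ ++ l₂) = depthAfter (depthAfter d l₁) l₂ := by
  induction l₁ generalizing d with
  | nil => rfl
  | cons g gs ih => exact ih _

theorem gatesDepth_append (d : W → ℕ) (l₁ l₂ : List (QGate W)) :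
    gatesDepth d (l₁ ++ l₂) = max (gatesDepth d l₁) (gatesDepth (depthAfter d l₁) l₂) := by
  induction l₁ generalizing d with
  | nil => simp [gatesDepth, depthAfter]
  | cons g gs ih => simp [gatesDepth, depthAfter, ih, max_assoc]

/-- The gates in `gs` only act on `S`, and they add at most `k` to the depth. -/
def DepthOn (gs : List (QGate W)) (S : Set W) (k : ℕ) : Prop :=
  ∀ (d : W → ℕ), (∀ w, w ∉ S → depthAfter d gs w = d w) ∧
    ∀ c : ℕ, (∀ w ∈ S, d w ≤ c) →
      gatesDepth d gs ≤ c + k ∧ ∀ w ∈ S, depthAfter d gs w ≤ c + k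

theorem DepthOn.nil (S : Set W) (k : ℕ) : DepthOn ([] : List (QGate W)) S k := by
  refine fun d => ⟨fun w _ => rfl, fun c hc => ⟨by simp [gatesDepth], fun w hw => ?_⟩⟩
  exact (hc w hw).trans (Nat.le_add_right _ _)

theorem DepthOn.append {l₁ l₂ : List (QGate W)} {S : Set W} {k₁ k₂ : ℕ} (h₁ : DepthOn l₁ S k₁)
    (h₂ : DepthOn l₂ S k₂) : DepthOn (l₁ ++ l₂) S (k₁ + k₂) := by
  intro d
  simp only [gatesDepth_append, depthAfter_append]
  refine ⟨fun w hw => by rw [(h₂ _).1 w hw, (h₁ d).1 w hw], fun c hc => ?_⟩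
  obtain ⟨ha, hb⟩ := (h₁ d).2 c hc
  obtain ⟨ha', hb'⟩ := (h₂ (depthAfter d l₁)).2 (c + k₁) hb
  refine ⟨max_le (by omega) (by omega), fun w hw => ?_⟩
  have := hb' w hw
  omega

theorem DepthOn.mono {gs : List (QGate W)} {S S' : Set W} {k : ℕ} (h : DepthOn gs S k)
    (hS : S ⊆ S') : DepthOn gs S' k := by
  intro d
  refine ⟨fun w hw => (h d).1 w fun h' => hw (hS h'), fun c hc => ?_⟩
  obtain ⟨ha, hb⟩ := (h d).2 c fun w hw => hc w (hS hw)
  refine ⟨ha, fun w hw => ?_⟩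
  by_cases hwS : w ∈ S
  · exact hb w hwS
  · rw [(h d).1 w hwS]
    exact (hc w hw).trans (Nat.le_add_right _ _)

theorem DepthOn.union {l₁ l₂ : List (QGate W)} {S₁ S₂ : Set W} {k : ℕ} (h₁ : DepthOn l₁ S₁ k)
    (h₂ : DepthOn l₂ S₂ k) (hd : Disjoint S₁ S₂) : DepthOn (l₁ ++ l₂) (S₁ ∪ S₂) k := by
  intro d
  simp only [gatesDepth_append, depthAfter_append]
  refine ⟨fun w hw => ?_, fun c hc => ?_⟩
  · rw [Set.mem_union, not_or] at hw
    rw [(h₂ _).1 w hw.2, (h₁ d).1 w hw.1]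
  · obtain ⟨ha, hb⟩ := (h₁ d).2 c fun w hw => hc w (Or.inl hw)
    obtain ⟨ha', hb'⟩ := (h₂ (depthAfter d l₁)).2 c fun w hw => by
      rw [(h₁ d).1 w (Set.disjoint_right.1 hd hw)]
      exact hc w (Or.inr hw)
    refine ⟨max_le ha ha', fun w hw => ?_⟩
    by_cases hw2 : w ∈ S₂
    · exact hb' w hw2
    · rw [(h₂ _).1 w hw2]
      exact hb w (hw.resolve_right hw2)

theorem DepthOn.flatMap {ι : Type*} {l : List ι} {f : ι → List (QGate W)} {S : ι → Set W} {k : ℕ}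
    (h : ∀ i ∈ l, DepthOn (f i) (S i) k) (hd : l.Pairwise fun i j => Disjoint (S i) (S j)) :
    DepthOn (l.flatMap f) {w | ∃ i ∈ l, w ∈ S i} k := by
  induction l with
  | nil => exact DepthOn.nil _ _
  | cons i l ih =>
    rw [List.pairwise_cons] at hd
    rw [List.flatMap_cons]
    refine ((h i (by simp)).union (ih (fun j hj => h j (by simp [hj])) hd.2) ?_).mono ?_
    · rw [Set.disjoint_left]
      rintro w hw ⟨j, hj, hwj⟩
      exact Set.disjoint_left.1 (hd.1 j hj) hw hwj
    · rintro w (hw | ⟨j, hj, hwj⟩)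
      · exact ⟨i, by simp, hw⟩
      · exact ⟨j, by simp [hj], hwj⟩

theorem DepthOn.singleton (g : QGate W) : DepthOn [g] (g.qubits : Set W) 1 := by
  intro d
  simp only [gatesDepth, depthAfter, QGate.depthAt]
  refine ⟨fun w hw => if_neg hw, fun c hc => ?_⟩
  have : g.qubits.sup d ≤ c := Finset.sup_le fun w hw => hc w hw
  exact ⟨by omega, fun w hw => by rw [if_pos (by exact_mod_cast hw)]; omega⟩

theorem DepthOn.fan (p : W) (T : Finset W) :
    DepthOn (fan p T) {w | T.Nonempty ∧ (w = p ∨ w ∈ T)} 1 := by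
  rw [_root_.fan]
  split_ifs with h
  · refine (DepthOn.singleton _).mono fun w hw => ?_
    simpa [QGate.qubits, h.1] using hw
  · exact DepthOn.nil _ _

theorem DepthOn.oneQubits {C : List W} (hC : C.Nodup) (U : W → Matrix.unitaryGroup Bool ℂ) :
    DepthOn (C.map fun c => QGate.oneQubit c (U c)) {w | w ∈ C} 1 := by
  rw [List.map_eq_flatMap]
  refine (DepthOn.flatMap (S := fun c => {c}) (fun c _ => ?_) ?_).mono ?_
  · exact (DepthOn.singleton _).mono (by simp [QGate.qubits])
  · exact hC.imp fun h => by simpa using h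
  · rintro w ⟨c, hc, rfl⟩
    exact hc

theorem DepthOn.block (p : W) (C : Finset W) (θ : W → ℝ) (θ₀ : ℝ) :
    DepthOn (block p C θ θ₀) (insert p (C : Set W)) 7 := by
  have h1 : ∀ U, DepthOn [QGate.oneQubit p U] (insert p (C : Set W)) 1 := fun U =>
    (DepthOn.singleton _).mono (by simp [QGate.qubits])
  have h2 : ∀ U : W → Matrix.unitaryGroup Bool ℂ,
      DepthOn (C.toList.map fun c => QGate.oneQubit c (U c)) (insert p (C : Set W)) 1 := fun U =>
    (DepthOn.oneQubits C.nodup_toList U).mono fun w hw => by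
      right; simpa using hw
  have h3 : DepthOn (_root_.fan p C) (insert p (C : Set W)) 1 :=
    (DepthOn.fan p C).mono fun w hw => by simpa using hw.2
  exact (h1 _).append ((h2 _).append (h3.append ((h2 _).append (h3.append ((h1 _).append (h1 _))))))

/-- The size of a sequence of gates. -/
def gatesSize (gs : List (QGate W)) : ℕ := (gs.map fun g => g.qubits.card).sum

theorem gatesSize_append (l₁ l₂ : List (QGate W)) :
    gatesSize (l₁ ++ l₂) = gatesSize l₁ + gatesSize l₂ := by simp [gatesSize]

theorem gatesSize_flatMap {ι : Type*} (l : List ι) (f : ι → List (QGate W)) :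
    gatesSize (l.flatMap f) = (l.map fun i => gatesSize (f i)).sum := by
  induction l with
  | nil => rfl
  | cons i l ih => simp [gatesSize_append, ih]

theorem gatesSize_oneQubits (C : List W) (U : W → Matrix.unitaryGroup Bool ℂ) :
    gatesSize (C.map fun c => QGate.oneQubit c (U c)) = C.length := by
  induction C with
  | nil => rfl
  | cons c C ih => simp_all [gatesSize, QGate.qubits, add_comm]

theorem gatesSize_fan_le (p : W) (T : Finset W) : gatesSize (fan p T) ≤ 2 * T.card := by
  rw [fan]
  split_ifs with h
  · have := h.1.card_pos
    have := Finset.card_insert_le p T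
    simp only [gatesSize, QGate.qubits, List.map_cons, List.map_nil, List.sum_cons, List.sum_nil]
    omega
  · simp [gatesSize]

theorem gatesSize_block_le (p : W) (C : Finset W) (θ : W → ℝ) (θ₀ : ℝ) :
    gatesSize (block p C θ θ₀) ≤ 6 * C.card + 3 := by
  have h1 : ∀ U, gatesSize [QGate.oneQubit p U] = 1 := fun U => by simp [gatesSize, QGate.qubits]
  have := gatesSize_fan_le p C
  simp only [block, gatesSize_append, h1, gatesSize_oneQubits, Finset.length_toList]
  omega

end GateSequences

/-- A parallel composition of controlled rotations: for every target `t` the operator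
`H diag (1, exp (i π θ)) H` is applied to `t`, where `θ` is `const t` plus the total weight of those
sources of `t` which are in the state `1`. -/
structure Stage (Q : Type) where
  targets : List Q
  src : Q → Finset Q
  weight : Q → Q → ℝ
  const : Q → ℝ

namespace Stage

variable {W Q : Type} [DecidableEq W] [DecidableEq Q] [Fintype Q]

/-- No target is repeated or serves as a source. -/
def WF (S : Stage Q) : Prop :=
  S.targets.Nodup ∧ ∀ t ∈ S.targets, ∀ t' ∈ S.targets, t ∉ S.src t'

/-- The stage that undoes `S`. -/
def inv (S : Stage Q) : Stage Q where
  targets := S.targets.reverse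
  src := S.src
  weight t i := -S.weight t i
  const t := -S.const t

theorem WF.inv {S : Stage Q} (h : S.WF) : S.inv.WF := by
  simpa [WF, Stage.inv] using h

/-- The angle by which a stage rotates the target `t` if the logical qubits hold `y`. -/
def angle (S : Stage Q) (t : Q) (y : Q → Bool) : ℝ :=
  S.const t + ∑ i ∈ S.src t, if y i then S.weight t i else 0

section Gates

variable (S : Stage Q) (dec : W ≃ Q ⊕ Q × Q)

/-- The copies of the sources of `t` that are used for the rotation of `t`. -/
def copies (t : Q) : Finset W := (S.src t).image fun i => dec.symm (Sum.inr (t, i))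

/-- The qubits to which the logical qubit `i` is copied. -/
def copyTargets (i : Q) : Finset W :=
  (S.targets.toFinset.filter fun t => i ∈ S.src t).image fun t => dec.symm (Sum.inr (t, i))

/-- The weights of the copies. -/
def copyWeight (w : W) : ℝ :=
  match dec w with
  | Sum.inl _ => 0
  | Sum.inr (t, i) => S.weight t i

/-- The layer of fan-out gates which copies the sources. -/
noncomputable def copyLayer : List (QGate W) :=
  (Finset.univ : Finset Q).toList.flatMap fun i => fan (dec.symm (Sum.inl i)) (S.copyTargets dec i)

/-- The gates of a stage. -/
noncomputable def gates : List (QGate W) :=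
  S.copyLayer dec ++
  ((S.targets.flatMap fun t =>
    block (dec.symm (Sum.inl t)) (S.copies dec t) (S.copyWeight dec) (S.const t)) ++
  S.copyLayer dec)

theorem mem_copyTargets {i : Q} {w : W} :
    w ∈ S.copyTargets dec i ↔ ∃ t ∈ S.targets, i ∈ S.src t ∧ dec w = Sum.inr (t, i) := by
  simp only [copyTargets, Finset.mem_image, Finset.mem_filter, List.mem_toFinset, and_assoc,
    Equiv.symm_apply_eq]
  exact ⟨fun ⟨t, h1, h2, h3⟩ => ⟨t, h1, h2, h3.symm⟩, fun ⟨t, h1, h2, h3⟩ => ⟨t, h1, h2, h3.symm⟩⟩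

theorem mem_copies {t : Q} {w : W} :
    w ∈ S.copies dec t ↔ ∃ i ∈ S.src t, dec w = Sum.inr (t, i) := by
  simp only [copies, Finset.mem_image, Equiv.symm_apply_eq]
  exact ⟨fun ⟨t, h1, h2⟩ => ⟨t, h1, h2.symm⟩, fun ⟨t, h1, h2⟩ => ⟨t, h1, h2.symm⟩⟩

theorem depthOn_copyLayer : DepthOn (S.copyLayer dec) Set.univ 1 := by
  refine (DepthOn.flatMap (fun i _ => DepthOn.fan _ _) ?_).mono (Set.subset_univ _)
  refine (Finset.nodup_toList _).imp fun {i j} hij => ?_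
  rw [Set.disjoint_left]
  rintro w ⟨-, hi⟩ ⟨-, hj⟩
  simp only [mem_copyTargets, Equiv.eq_symm_apply] at hi hj
  rcases hi with hi | ⟨k, -, -, hi⟩ <;> rcases hj with hj | ⟨k', -, -, hj⟩ <;> simp_all

theorem depthOn_gates (hS : S.WF) : DepthOn (S.gates dec) Set.univ 9 := by
  refine (S.depthOn_copyLayer dec).append (DepthOn.append (k₁ := 7) ?_ (S.depthOn_copyLayer dec))
  refine (DepthOn.flatMap (fun i _ => DepthOn.block _ _ _ _) ?_).mono (Set.subset_univ _)
  refine hS.1.imp fun {i j} hij => ?_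
  rw [Set.disjoint_left]
  rintro w hi hj
  simp only [Set.mem_insert_iff, Finset.mem_coe, mem_copies, Equiv.eq_symm_apply] at hi hj
  rcases hi with hi | ⟨k, -, hi⟩ <;> rcases hj with hj | ⟨k', -, hj⟩ <;> simp_all

theorem gatesSize_copyLayer_le (hS : S.WF) :
    gatesSize (S.copyLayer dec) ≤ 2 * (S.targets.map fun t => (S.src t).card).sum := by
  have h1 : gatesSize (S.copyLayer dec) ≤ ∑ i : Q, 2 * (S.copyTargets dec i).card := by
    rw [copyLayer, gatesSize_flatMap, ← Finset.sum_map_toList]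
    exact List.sum_le_sum fun i _ => gatesSize_fan_le _ _
  have h2 : ∑ i : Q, (S.copyTargets dec i).card ≤
      ∑ i : Q, (S.targets.toFinset.filter fun t => i ∈ S.src t).card :=
    Finset.sum_le_sum fun i _ => Finset.card_image_le
  have h3 : ∑ i : Q, (S.targets.toFinset.filter fun t => i ∈ S.src t).card =
      ∑ t ∈ S.targets.toFinset, (S.src t).card := by
    simp only [Finset.card_filter]
    rw [Finset.sum_comm]
    simp
  rw [← Finset.mul_sum] at h1
  rw [← List.sum_toFinset _ hS.1]
  omega

theorem gatesSize_gates_le (hS : S.WF) :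
    gatesSize (S.gates dec) ≤ (S.targets.map fun t => 10 * (S.src t).card + 3).sum := by
  have h1 := S.gatesSize_copyLayer_le dec hS
  have h2 : gatesSize (S.targets.flatMap fun t =>
      block (dec.symm (Sum.inl t)) (S.copies dec t) (S.copyWeight dec) (S.const t)) ≤
      (S.targets.map fun t => 6 * (S.src t).card + 3).sum := by
    rw [gatesSize_flatMap]
    refine List.sum_le_sum fun t _ => (gatesSize_block_le _ _ _ _).trans ?_
    have : (S.copies dec t).card ≤ _ := Finset.card_image_le
    omega
  rw [gates, gatesSize_append, gatesSize_append]
  simp only [List.sum_map_add, List.sum_map_mul_left] at *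
  omega

/-- The permutation of labels performed by those fan-out gates of the copy layer whose controls
satisfy `I`. -/
def copyMap (I : List Q) (v : W → Bool) (w : W) : Bool :=
  match dec w with
  | Sum.inl _ => v w
  | Sum.inr (t, i) =>
    xor (v w) (decide (t ∈ S.targets ∧ i ∈ S.src t ∧ i ∈ I) && v (dec.symm (Sum.inl i)))

theorem copyMap_inl (I : List Q) (v : W → Bool) (i : Q) :
    S.copyMap dec I v (dec.symm (Sum.inl i)) = v (dec.symm (Sum.inl i)) := by
  simp [copyMap]

theorem copyMap_inr (I : List Q) (v : W → Bool) (t i : Q) :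
    S.copyMap dec I v (dec.symm (Sum.inr (t, i))) = xor (v (dec.symm (Sum.inr (t, i))))
      (decide (t ∈ S.targets ∧ i ∈ S.src t ∧ i ∈ I) && v (dec.symm (Sum.inl i))) := by
  simp [copyMap]

theorem funext_dec {v v' : W → Bool}
    (h1 : ∀ i, v (dec.symm (Sum.inl i)) = v' (dec.symm (Sum.inl i)))
    (h2 : ∀ t i, v (dec.symm (Sum.inr (t, i))) = v' (dec.symm (Sum.inr (t, i)))) : v = v' := by
  funext w
  obtain ⟨q, rfl⟩ := dec.symm.surjective w
  rcases q with i | ⟨t, i⟩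
  exacts [h1 i, h2 t i]

theorem copyMap_copyMap (I : List Q) (v : W → Bool) :
    S.copyMap dec I (S.copyMap dec I v) = v := by
  refine funext_dec dec (fun i => ?_) fun t i => ?_
  · simp only [copyMap_inl]
  · simp only [copyMap_inr, copyMap_inl, Bool.xor_assoc, Bool.xor_self, Bool.xor_false]

theorem gatesOp_fans {I : List Q} (hI : I.Nodup) (ψ : QState W) (v : W → Bool) :
    gatesOp (I.flatMap fun i => fan (dec.symm (Sum.inl i)) (S.copyTargets dec i)) ψ v =
      ψ (S.copyMap dec I v) := by
  have hnot : ∀ i, dec.symm (Sum.inl i) ∉ S.copyTargets dec i := fun i h => by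
    simp [mem_copyTargets] at h
  induction I generalizing ψ with
  | nil =>
    refine congrArg ψ (funext_dec dec (fun i => ?_) fun t i => ?_)
    · simp only [copyMap_inl]
    · simp [copyMap_inr]
  | cons i I ih =>
    rw [List.nodup_cons] at hI
    rw [List.flatMap_cons, gatesOp_append, LinearMap.comp_apply, ih hI.2, gatesOp_fan (hnot i)]
    refine congrArg ψ (funext_dec dec (fun j => ?_) fun t j => ?_)
    · simp [copyMap_inl, QGate.fanOutMap, mem_copyTargets]
    · simp only [QGate.fanOutMap, mem_copyTargets, copyMap_inl, copyMap_inr, Equiv.apply_symm_apply,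
        Sum.inr.injEq, Prod.mk.injEq, List.mem_cons]
      by_cases h1 : t ∈ S.targets <;> by_cases h2 : j ∈ S.src t <;> by_cases h3 : j = i <;>
        by_cases h4 : j ∈ I <;> simp_all

theorem gatesOp_copyLayer (ψ : QState W) (v : W → Bool) :
    gatesOp (S.copyLayer dec) ψ v = ψ (S.copyMap dec Finset.univ.toList v) :=
  S.gatesOp_fans dec (Finset.nodup_toList _) ψ v

theorem copyMap_flipBit (hS : S.WF) {t : Q} (ht : t ∈ S.targets) (I : List Q) (v : W → Bool) :
    S.copyMap dec I (flipBit (dec.symm (Sum.inl t)) v) =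
      flipBit (dec.symm (Sum.inl t)) (S.copyMap dec I v) := by
  refine funext_dec dec (fun i => ?_) fun t' i => ?_
  · simp [flipBit, Function.update_apply, copyMap_inl]
  · have : t' ∈ S.targets → i ∈ S.src t' → i ≠ t := by
      rintro h1 h2 rfl
      exact hS.2 i ht t' h1 h2
    simp only [copyMap_inr, flipBit, Function.update_apply, Equiv.apply_eq_iff_eq, reduceCtorEq,
      if_false, Sum.inl.injEq]
    by_cases h1 : t' ∈ S.targets <;> by_cases h2 : i ∈ S.src t' <;> simp_all

/-- The angle by which the gates of a stage rotate the target `t`, if the qubits used for the copies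
hold arbitrary values. -/
def fullAngle (t : Q) (v : W → Bool) : ℝ :=
  S.const t + ∑ i ∈ S.src t, if xor (v (dec.symm (Sum.inr (t, i)))) (v (dec.symm (Sum.inl i)))
    then S.weight t i else 0

/-- The composition of the rotations of the targets in a list. -/
noncomputable def rots (ts : List Q) : QState W →ₗ[ℂ] QState W :=
  match ts with
  | [] => LinearMap.id
  | t :: ts => (rots ts).comp (rot (dec.symm (Sum.inl t)) fun v => phase (S.fullAngle dec t v))

theorem gatesOp_gates (hS : S.WF) : gatesOp (S.gates dec) = S.rots dec S.targets := by
  set κ : (W → Bool) → W → Bool := S.copyMap dec Finset.univ.toList with hκ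
  have key : ∀ ts : List Q, (∀ t ∈ ts, t ∈ S.targets) → ∀ (φ : QState W) (v : W → Bool),
      gatesOp (ts.flatMap fun t => block (dec.symm (Sum.inl t)) (S.copies dec t)
        (S.copyWeight dec) (S.const t)) (fun v => φ (κ v)) (κ v) = S.rots dec ts φ v := by
    intro ts
    induction ts with
    | nil => intro _ φ v; simp [gatesOp, rots, hκ, copyMap_copyMap]
    | cons t ts ih =>
      intro hts φ v
      have ht := hts t (by simp)
      rw [List.flatMap_cons, gatesOp_append, LinearMap.comp_apply, rots, LinearMap.comp_apply,
        ← ih fun t' h => hts t' (by simp [h])]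
      rw [gatesOp_block]
      · refine congrFun (congrArg _ (funext fun v' => ?_)) _
        rw [rot_apply, rot_apply]
        have : S.const t + (∑ c ∈ S.copies dec t, if v' c then S.copyWeight dec c else 0) =
            S.fullAngle dec t (κ v') := by
          rw [fullAngle, copies, Finset.sum_image (by simp)]
          congr 1
          refine Finset.sum_congr rfl fun i hi => ?_
          simp [hκ, copyMap_inr, copyMap_inl, ht, hi, copyWeight]
        rw [this, hκ, S.copyMap_flipBit dec hS ht]
      · simp [mem_copies]
  ext1 ψ
  funext v
  rw [gates, gatesOp_append, gatesOp_append, LinearMap.comp_apply, LinearMap.comp_apply,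
    gatesOp_copyLayer]
  rw [← key S.targets (fun _ h => h) ψ v]
  refine congrFun (congrArg _ (funext fun v' => ?_)) _
  exact S.gatesOp_copyLayer dec ψ v'

end Gates

end Stage

namespace Stage

variable {W Q : Type} [DecidableEq W] [DecidableEq Q] [Fintype Q]

/-- The transitions between basis states of the logical qubits that can have a nonzero amplitude. -/
def Step (S : Stage Q) (y y' : Q → Bool) : Prop :=
  (∀ i, i ∉ S.targets → y' i = y i) ∧ ∀ t ∈ S.targets,
    (y' t = y t ∧ phase (S.angle t y) ≠ -1) ∨ (y' t = !y t ∧ phase (S.angle t y) ≠ 1)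

/-- A sequence of transitions. -/
def Steps : List (Stage Q) → (Q → Bool) → (Q → Bool) → Prop
  | [], y, y' => y' = y
  | S :: Ss, y, y' => ∃ y₁, S.Step y y₁ ∧ Steps Ss y₁ y'

variable (S : Stage Q) (dec : W ≃ Q ⊕ Q × Q)

/-- All the qubits that are used for copies hold `0`. -/
def Clean (v : W → Bool) : Prop := ∀ p, v (dec.symm (Sum.inr p)) = false

/-- The values of the logical qubits. -/
def logical (v : W → Bool) (i : Q) : Bool := v (dec.symm (Sum.inl i))

theorem fullAngle_of_clean {v : W → Bool} (hv : Clean dec v) (t : Q) :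
    S.fullAngle dec t v = S.angle t (logical dec v) := by
  simp only [fullAngle, angle, logical, hv _, Bool.false_xor]
  rfl

theorem fullAngle_flipBit {t z : Q} (hz : z ∉ S.src t) (v : W → Bool) :
    S.fullAngle dec t (flipBit (dec.symm (Sum.inl z)) v) = S.fullAngle dec t v := by
  rw [fullAngle, fullAngle]
  congr 1
  refine Finset.sum_congr rfl fun i hi => ?_
  have hiz : i ≠ z := by rintro rfl; exact hz hi
  rw [flipBit_of_ne (by simp), flipBit_of_ne (by simpa using hiz)]

theorem inv_fullAngle (t : Q) (v : W → Bool) :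
    S.inv.fullAngle dec t v = -S.fullAngle dec t v := by
  simp only [fullAngle, inv, neg_add, ← Finset.sum_neg_distrib]
  congr 1
  refine Finset.sum_congr rfl fun i _ => ?_
  split_ifs <;> simp

theorem rots_append (l₁ l₂ : List Q) :
    S.rots dec (l₁ ++ l₂) = (S.rots dec l₂).comp (S.rots dec l₁) := by
  induction l₁ with
  | nil => simp [rots]
  | cons t ts ih => simp [rots, ih, LinearMap.comp_assoc]

theorem gatesOp_inv_comp (hS : S.WF) :
    (gatesOp (S.inv.gates dec)).comp (gatesOp (S.gates dec)) = LinearMap.id := by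
  rw [gatesOp_gates _ _ hS, gatesOp_gates _ _ hS.inv]
  change (S.inv.rots dec S.targets.reverse).comp _ = _
  have : ∀ ts : List Q, (∀ t ∈ ts, t ∈ S.targets) →
      (S.inv.rots dec ts.reverse).comp (S.rots dec ts) = LinearMap.id := by
    intro ts
    induction ts with
    | nil => intro _; simp [rots]
    | cons t ts ih =>
      intro hts
      have h := ih fun t' h => hts t' (by simp [h])
      have ht := hts t (by simp)
      rw [List.reverse_cons, rots_append, rots, rots, rots, LinearMap.comp_assoc,
        ← LinearMap.comp_assoc _ (S.rots dec ts), h, LinearMap.id_comp, LinearMap.id_comp]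
      refine rot_comp_rot (fun v => ?_) fun v => ?_
      · rw [S.fullAngle_flipBit dec (hS.2 t ht t ht)]
      · rw [inv_fullAngle, phase_neg_mul]
  exact this _ fun _ h => h

theorem rots_flipBit {z : Q} {ts : List Q} (hz : ∀ t ∈ ts, z ∉ S.src t) (φ : QState W) :
    S.rots dec ts (fun v => φ (flipBit (dec.symm (Sum.inl z)) v)) =
      fun v => S.rots dec ts φ (flipBit (dec.symm (Sum.inl z)) v) := by
  induction ts generalizing φ with
  | nil => rfl
  | cons t ts ih =>
    rw [rots, LinearMap.comp_apply, LinearMap.comp_apply, ← ih fun t' h => hz t' (by simp [h])]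
    congr 1
    funext v
    rw [rot_apply, rot_apply, S.fullAngle_flipBit dec (hz t (by simp)), flipBit_comm]

theorem exists_of_rots_ne_zero (hS : S.WF) {ts : List Q} (hts : ∀ t ∈ ts, t ∈ S.targets)
    (hnd : ts.Nodup) {ψ : QState W} {v' : W → Bool} (h : S.rots dec ts ψ v' ≠ 0) :
    ∃ v, ψ v ≠ 0 ∧ (∀ w, (∀ t ∈ ts, w ≠ dec.symm (Sum.inl t)) → v' w = v w) ∧
      ∀ t ∈ ts, (v' (dec.symm (Sum.inl t)) = v (dec.symm (Sum.inl t)) ∧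
        phase (S.fullAngle dec t v) ≠ -1) ∨ (v' (dec.symm (Sum.inl t)) =
        !v (dec.symm (Sum.inl t)) ∧ phase (S.fullAngle dec t v) ≠ 1) := by
  induction ts generalizing ψ with
  | nil => exact ⟨v', h, by simp, by simp⟩
  | cons t ts ih =>
    rw [List.nodup_cons] at hnd
    have hts' : ∀ t ∈ ts, t ∈ S.targets := fun t' h' => hts t' (by simp [h'])
    have ht := hts t (by simp)
    obtain ⟨v, hv, hoff, hon⟩ := ih hts' hnd.2 h
    have hvt := hoff (dec.symm (Sum.inl t)) fun t' h' heq => by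
      simp only [Equiv.apply_eq_iff_eq, Sum.inl.injEq] at heq
      exact hnd.1 (heq ▸ h')
    rw [rot_apply] at hv
    by_cases h1 : ψ v ≠ 0 ∧ phase (S.fullAngle dec t v) ≠ -1
    · refine ⟨v, h1.1, fun w hw => hoff w fun t' h' => hw t' (by simp [h']), fun t' h' => ?_⟩
      rcases List.mem_cons.1 h' with rfl | h'
      exacts [Or.inl ⟨hvt, h1.2⟩, hon t' h']
    · have h0 : (1 + phase (S.fullAngle dec t v)) / 2 * ψ v = 0 := by
        by_cases hz : ψ v = 0
        · rw [hz, mul_zero]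
        · have := not_not.1 fun hne => h1 ⟨hz, hne⟩
          rw [this]; simp
      rw [h0, zero_add] at hv
      have hu : phase (S.fullAngle dec t v) ≠ 1 := fun h' => hv (by rw [h']; simp)
      have hf := fun t' (h' : t' ∈ S.targets) =>
        S.fullAngle_flipBit dec (hS.2 t ht t' h') v
      refine ⟨flipBit (dec.symm (Sum.inl t)) v, fun h' => hv (by rw [h', mul_zero]),
        fun w hw => ?_, fun t' h'' => ?_⟩
      · rw [flipBit_of_ne (hw t (by simp))]
        exact hoff w fun t' h' => hw t' (by simp [h'])
      · rcases List.mem_cons.1 h'' with rfl | h'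
        · right
          rw [hf _ ht, flipBit_self, Bool.not_not]
          exact ⟨hvt, hu⟩
        · rw [hf _ (hts' t' h'), flipBit_of_ne]
          · exact hon t' h'
          · simp only [ne_eq, Equiv.apply_eq_iff_eq, Sum.inl.injEq]
            rintro rfl
            exact hnd.1 h'

/-- All labels of nonzero amplitude are clean and have logical parts that satisfy `P`. -/
def SupportedBy (ψ : QState W) (P : (Q → Bool) → Prop) : Prop :=
  ∀ v, ψ v ≠ 0 → Clean dec v ∧ P (logical dec v)

variable {dec S}

theorem SupportedBy.gatesOp_gates (hS : S.WF) {ψ : QState W} {P : (Q → Bool) → Prop}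
    (h : SupportedBy dec ψ P) :
    SupportedBy dec (gatesOp (S.gates dec) ψ) fun y' => ∃ y, P y ∧ S.Step y y' := by
  intro v' hv'
  rw [Stage.gatesOp_gates S dec hS] at hv'
  obtain ⟨v, hv, hoff, hon⟩ := S.exists_of_rots_ne_zero dec hS (fun _ h => h) hS.1 hv'
  obtain ⟨hc, hP⟩ := h v hv
  refine ⟨fun p => ?_, logical dec v, hP, fun i hi => ?_, fun t ht => ?_⟩
  · rw [hoff _ (by simp), hc]
  · refine hoff _ fun t ht heq => ?_
    simp only [Equiv.apply_eq_iff_eq, Sum.inl.injEq] at heq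
    exact hi (heq ▸ ht)
  · have := hon t ht
    rwa [S.fullAngle_of_clean dec hc] at this

theorem SupportedBy.flatMap {Ss : List (Stage Q)} (hS : ∀ S ∈ Ss, S.WF) {ψ : QState W}
    {P : (Q → Bool) → Prop} (h : SupportedBy dec ψ P) :
    SupportedBy dec (gatesOp (Ss.flatMap fun S => S.gates dec) ψ)
      fun y' => ∃ y, P y ∧ Steps Ss y y' := by
  induction Ss generalizing ψ P with
  | nil => exact fun v hv => ⟨(h v hv).1, _, (h v hv).2, rfl⟩
  | cons S Ss ih =>
    rw [List.flatMap_cons, gatesOp_append]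
    intro v hv
    obtain ⟨hc, y, ⟨y₀, hy₀, hy⟩, hs⟩ :=
      ih (fun S' h' => hS S' (by simp [h'])) (h.gatesOp_gates (hS S (by simp))) v hv
    exact ⟨hc, y₀, hy₀, y, hy, hs⟩

variable (dec)

/-- Compute with the stages in `Ss`, apply `F`, and uncompute. -/
noncomputable def conjGates (Ss : List (Stage Q)) (F : Stage Q) : List (QGate W) :=
  (Ss.flatMap fun S => S.gates dec) ++
    (F.gates dec ++ Ss.reverse.flatMap fun S => S.inv.gates dec)

theorem gatesOp_inv_flatMap_comp {Ss : List (Stage Q)} (hS : ∀ S ∈ Ss, S.WF) :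
    (gatesOp (Ss.reverse.flatMap fun S => S.inv.gates dec)).comp
      (gatesOp (Ss.flatMap fun S => S.gates dec)) = LinearMap.id := by
  induction Ss with
  | nil => rfl
  | cons S Ss ih =>
    rw [List.reverse_cons, List.flatMap_append, gatesOp_append, List.flatMap_cons (xs := Ss),
      gatesOp_append, LinearMap.comp_assoc, ← LinearMap.comp_assoc _ (gatesOp (Ss.flatMap _)),
      ih fun S' h' => hS S' (by simp [h']), LinearMap.id_comp]
    simpa using gatesOp_inv_comp S dec (hS S (by simp))

theorem gatesOp_flatMap_flipBit {z : Q} {Ss : List (Stage Q)} (hS : ∀ S ∈ Ss, S.WF)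
    (hz : ∀ S ∈ Ss, ∀ t ∈ S.targets, z ∉ S.src t) (φ : QState W) :
    gatesOp (Ss.flatMap fun S => S.gates dec) (fun v => φ (flipBit (dec.symm (Sum.inl z)) v)) =
      fun v => gatesOp (Ss.flatMap fun S => S.gates dec) φ (flipBit (dec.symm (Sum.inl z)) v) := by
  induction Ss generalizing φ with
  | nil => rfl
  | cons S Ss ih =>
    rw [List.flatMap_cons, gatesOp_append, LinearMap.comp_apply, LinearMap.comp_apply,
      gatesOp_gates _ _ (hS S (by simp)), rots_flipBit _ _ (hz S (by simp)),
      ih (fun S' h' => hS S' (by simp [h'])) fun S' h' => hz S' (by simp [h'])]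

theorem gatesOp_conjGates_ket [Fintype W] {Ss : List (Stage Q)} {F : Stage Q} {z : Q}
    (hS : ∀ S ∈ Ss, S.WF) (hz : ∀ S ∈ Ss, ∀ t ∈ S.targets, z ∉ S.src t) (hF : F.targets = [z])
    (hzF : z ∉ F.src z) {v : W → Bool} (hv : Clean dec v) {b : Bool}
    (h : ∀ y, Steps Ss (logical dec v) y → phase (F.angle z y) = if b then -1 else 1) :
    gatesOp (conjGates dec Ss F) (ket v) =
      ket (if b then flipBit (dec.symm (Sum.inl z)) v else v) := by
  have hFWF : F.WF := by simp [WF, hF, hzF]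
  have hsupp : SupportedBy dec (ket v) fun y => y = logical dec v := by
    intro v' hv'
    have : v' = v := by
      by_contra hne
      exact hv' (by simp [ket, hne])
    subst this
    exact ⟨hv, rfl⟩
  have hsupp' := hsupp.flatMap hS
  set φ := gatesOp (Ss.flatMap fun S => S.gates dec) (ket v) with hφ
  have hang : ∀ v', φ v' ≠ 0 → phase (F.fullAngle dec z v') = if b then -1 else 1 := by
    intro v' hv'
    obtain ⟨hc, _, rfl, hst⟩ := hsupp' v' hv'
    rw [F.fullAngle_of_clean dec hc, h _ hst]
  have hmid : gatesOp (F.gates dec) φ = gatesOp (Ss.flatMap fun S => S.gates dec)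
      (ket (if b then flipBit (dec.symm (Sum.inl z)) v else v)) := by
    have h1 : ket (if b then flipBit (dec.symm (Sum.inl z)) v else v) =
        fun v' => ket v (if b then flipBit (dec.symm (Sum.inl z)) v' else v') := by
      funext v'
      cases b
      · rfl
      · simp only [ket, Pi.single_apply, if_true]
        congr 1
        rw [eq_iff_iff]
        constructor
        · rintro rfl; simp
        · rintro rfl; simp
    have h2 : gatesOp (Ss.flatMap fun S => S.gates dec)
        (fun v' => ket v (if b then flipBit (dec.symm (Sum.inl z)) v' else v')) =
        fun v' => φ (if b then flipBit (dec.symm (Sum.inl z)) v' else v') := by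
      cases b
      · rfl
      · exact gatesOp_flatMap_flipBit dec hS hz _
    rw [h1, h2, gatesOp_gates _ _ hFWF, hF]
    funext v'
    change (1 + phase (F.fullAngle dec z v')) / 2 * φ v' +
      (1 - phase (F.fullAngle dec z v')) / 2 * φ (flipBit (dec.symm (Sum.inl z)) v') = _
    have h3 : φ v' = 0 ∧ φ (flipBit (dec.symm (Sum.inl z)) v') = 0 ∨
        phase (F.fullAngle dec z v') = if b then -1 else 1 := by
      by_cases ha : φ v' = 0
      · by_cases hb : φ (flipBit (dec.symm (Sum.inl z)) v') = 0
        · exact Or.inl ⟨ha, hb⟩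
        · right
          rw [← hang _ hb, F.fullAngle_flipBit dec hzF]
      · exact Or.inr (hang _ ha)
    rcases h3 with ⟨ha, hb⟩ | h3
    · cases b <;> simp [ha, hb]
    · rw [h3]
      cases b <;> simp
  rw [conjGates, gatesOp_append, gatesOp_append, LinearMap.comp_apply, LinearMap.comp_apply, ← hφ,
    hmid, ← LinearMap.comp_apply, gatesOp_inv_flatMap_comp dec hS, LinearMap.id_apply]

/-- An upper bound for the size of the circuit for a stage. -/
def cost (S : Stage Q) : ℕ := (S.targets.map fun t => 10 * (S.src t).card + 3).sum

theorem cost_inv (S : Stage Q) : S.inv.cost = S.cost := by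
  simp only [cost, inv, List.map_reverse, List.sum_reverse]

theorem depthOn_conjGates {Ss : List (Stage Q)} {F : Stage Q} (hS : ∀ S ∈ Ss, S.WF) (hF : F.WF) :
    DepthOn (conjGates dec Ss F) Set.univ (9 * Ss.length + (9 + 9 * Ss.length)) := by
  refine DepthOn.append ?_ ((F.depthOn_gates dec hF).append ?_)
  · induction Ss with
    | nil => exact DepthOn.nil _ _
    | cons S Ss ih =>
      rw [List.flatMap_cons, List.length_cons, mul_add, add_comm]
      exact (S.depthOn_gates dec (hS S (by simp))).append (ih fun S' h' => hS S' (by simp [h']))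
  · induction Ss with
    | nil => exact DepthOn.nil _ _
    | cons S Ss ih =>
      rw [List.reverse_cons, List.flatMap_append, List.length_cons, mul_add]
      refine (ih fun S' h' => hS S' (by simp [h'])).append ?_
      simpa using S.inv.depthOn_gates dec (hS S (by simp)).inv

theorem gatesSize_conjGates_le {Ss : List (Stage Q)} {F : Stage Q} (hS : ∀ S ∈ Ss, S.WF)
    (hF : F.WF) : gatesSize (conjGates dec Ss F) ≤ 2 * (Ss.map cost).sum + F.cost := by
  have h1 : gatesSize (Ss.flatMap fun S => S.gates dec) ≤ (Ss.map cost).sum := by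
    rw [gatesSize_flatMap]
    exact List.sum_le_sum fun S h => S.gatesSize_gates_le dec (hS S h)
  have h2 : gatesSize (Ss.reverse.flatMap fun S => S.inv.gates dec) ≤ (Ss.map cost).sum := by
    rw [gatesSize_flatMap, List.map_reverse, List.sum_reverse]
    exact List.sum_le_sum fun S h =>
      (S.inv.gatesSize_gates_le dec (hS S h).inv).trans_eq S.cost_inv
  have h3 := F.gatesSize_gates_le dec hF
  rw [conjGates, gatesSize_append, gatesSize_append]
  change _ ≤ F.cost at h3
  omega

end Stage

/-- The decomposition of the qubits of a circuit into logical qubits and qubits for copies. -/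
def decodeQubit (n : ℕ) (A : Type) :
    Fin n ⊕ Unit ⊕ (A ⊕ (Fin n ⊕ Unit ⊕ A) × (Fin n ⊕ Unit ⊕ A)) ≃
      (Fin n ⊕ Unit ⊕ A) ⊕ (Fin n ⊕ Unit ⊕ A) × (Fin n ⊕ Unit ⊕ A) where
  toFun
    | Sum.inl i => Sum.inl (Sum.inl i)
    | Sum.inr (Sum.inl u) => Sum.inl (Sum.inr (Sum.inl u))
    | Sum.inr (Sum.inr (Sum.inl a)) => Sum.inl (Sum.inr (Sum.inr a))
    | Sum.inr (Sum.inr (Sum.inr p)) => Sum.inr p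
  invFun
    | Sum.inl (Sum.inl i) => Sum.inl i
    | Sum.inl (Sum.inr (Sum.inl u)) => Sum.inr (Sum.inl u)
    | Sum.inl (Sum.inr (Sum.inr a)) => Sum.inr (Sum.inr (Sum.inl a))
    | Sum.inr p => Sum.inr (Sum.inr (Sum.inr p))
  left_inv := by rintro (i | u | a | p) <;> rfl
  right_inv := by rintro ((i | u | a) | p) <;> rfl

/-- The initial values of the logical qubits. -/
def initialLabel {n : ℕ} (A : Type) (x : Fin n → Bool) (z : Bool) : Fin n ⊕ Unit ⊕ A → Bool :=
  Sum.elim x (Sum.elim (fun _ => z) fun _ => false)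

set_option synthInstance.maxSize 1000 in
theorem exists_circuit_of_stages {n : ℕ} {A : Type} [Fintype A] [DecidableEq A]
    {Ss : List (Stage (Fin n ⊕ Unit ⊕ A))} {F : Stage (Fin n ⊕ Unit ⊕ A)}
    {f : (Fin n → Bool) → Bool} (hS : ∀ S ∈ Ss, S.WF)
    (hz : ∀ S ∈ Ss, ∀ t ∈ S.targets, Sum.inr (Sum.inl ()) ∉ S.src t)
    (hF : F.targets = [Sum.inr (Sum.inl ())])
    (hzF : Sum.inr (Sum.inl ()) ∉ F.src (Sum.inr (Sum.inl ())))
    (h : ∀ x z y, Stage.Steps Ss (initialLabel A x z) y →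
      phase (F.angle (Sum.inr (Sum.inl ())) y) = if f x then -1 else 1) :
    ∃ C : QCircuit n, C.Computes f ∧ C.depth ≤ 18 * Ss.length + 9 ∧
      C.size ≤ 2 * (Ss.map Stage.cost).sum + F.cost := by
  have hFWF : F.WF := by simp [Stage.WF, hF, hzF]
  refine ⟨⟨A ⊕ (Fin n ⊕ Unit ⊕ A) × (Fin n ⊕ Unit ⊕ A),
    Stage.conjGates (decodeQubit n A) Ss F⟩, fun x z => ?_, ?_, ?_⟩
  · refine (Stage.gatesOp_conjGates_ket (decodeQubit n A) hS hz hF hzF (fun p => rfl) (b := f x)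
      fun y hy => h x z y ?_).trans (congrArg ket ?_)
    · convert hy using 1
      funext i
      rcases i with i | u | a <;> rfl
    · cases hb : f x
      · simp
      · funext w
        rcases w with i | u | a | p <;>
          simp [flipBit, decodeQubit, QCircuit.label]
  · have := ((Stage.depthOn_conjGates (decodeQubit n A) hS hFWF) fun _ => 0).2 0 (by simp)
    refine this.1.trans ?_
    omega
  · exact Stage.gatesSize_conjGates_le (decodeQubit n A) hS hFWF

theorem phase_natCast (m : ℕ) : phase m = if m % 2 = 1 then -1 else 1 := by
  rcases Nat.even_or_odd' m with ⟨k, rfl | rfl⟩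
  · rw [if_neg (by omega)]
    exact_mod_cast phase_int_even k
  · rw [if_pos (by omega)]
    exact_mod_cast phase_int_odd k

/-- The parities of all the subfamilies of a family of bits determine the disjunction of the
bits linearly. -/
theorem sum_parity_eq_or {L : ℕ} (m : Fin L → ℕ) (r : Finset (Fin L) → Bool)
    (hr : ∀ S, r S = decide ((∑ k ∈ S, m k) % 2 = 1)) :
    2 / 2 ^ L * ∑ S, (if r S then (1 : ℝ) else 0) = if ∃ k, m k % 2 = 1 then 1 else 0 := by
  have h1 : ∀ S, (if r S then (1 : ℝ) else 0) = (1 - ∏ k ∈ S, (-1) ^ m k) / 2 := by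
    intro S
    rw [hr, Finset.prod_pow_eq_pow_sum]
    rcases Nat.even_or_odd (∑ k ∈ S, m k) with h | h
    · rw [h.neg_one_pow, if_neg (by simpa [Nat.even_iff] using h)]; norm_num
    · rw [h.neg_one_pow, if_pos (by simpa [Nat.odd_iff] using h)]; norm_num
  have h2 : ∑ S : Finset (Fin L), ∏ k ∈ S, (-1 : ℝ) ^ m k = ∏ k, (1 + (-1 : ℝ) ^ m k) := by
    rw [Finset.prod_one_add, Finset.powerset_univ]
  have h3 : (2 : ℝ) ^ L ≠ 0 := by positivity
  rw [Finset.sum_congr rfl fun S _ => h1 S, ← Finset.sum_div, Finset.sum_sub_distrib, h2]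
  simp only [Finset.sum_const, Finset.card_univ, Fintype.card_finset, Fintype.card_fin,
    nsmul_eq_mul, mul_one, Nat.cast_pow, Nat.cast_ofNat]
  split_ifs with h
  · obtain ⟨k, hk⟩ := h
    rw [Finset.prod_eq_zero (Finset.mem_univ k)]
    · field_simp; ring
    · rw [(Nat.odd_iff.2 hk).neg_one_pow]; norm_num
  · push Not at h
    have : ∀ k, (1 + (-1 : ℝ) ^ m k) = 2 := fun k => by
      rw [(Nat.even_iff.2 (Nat.mod_two_ne_one.1 (h k))).neg_one_pow]; norm_num
    simp [this]

namespace Stage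

variable {Q : Type} [DecidableEq Q] {S : Stage Q} {y y' : Q → Bool}

theorem Step.eq_xor (h : S.Step y y') {t : Q} (ht : t ∈ S.targets) {m : ℕ}
    (hm : S.angle t y = m) : y' t = xor (y t) (decide (m % 2 = 1)) := by
  have := h.2 t ht
  rw [hm, phase_natCast] at this
  by_cases h2 : m % 2 = 1
  · simp only [h2, if_true, ne_eq, not_true_eq_false, and_false, false_or] at this
    simp [h2, this.1]
  · simp only [h2, if_false, ne_eq, not_true_eq_false, and_false, or_false] at this
    simp [h2, this.1]

theorem cost_le {B : ℕ} (hB : ∀ t ∈ S.targets, (S.src t).card ≤ B) :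
    S.cost ≤ S.targets.length * (10 * B + 3) := by
  rw [cost, ← smul_eq_mul, ← List.length_map (as := S.targets)]
  refine List.sum_le_card_nsmul _ _ fun m hm => ?_
  obtain ⟨t, ht, rfl⟩ := List.mem_map.1 hm
  have := hB t ht
  omega

end Stage

/-- The logical ancillary qubits of the threshold circuit. -/
inductive ThresholdAnc (a L : ℕ) (J : Type) : Type
  | digit (k : Fin a) (g : Fin (2 ^ k.val))
  | mismatch (s : Fin (2 ^ a)) (S : Finset (Fin a))
  | residue (s : Fin (2 ^ a))
  | quotient (j : J) (k : Fin L)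
  | parity (j : J) (S : Finset (Fin L))
  deriving DecidableEq, Fintype

namespace ThresholdCircuit

open ThresholdAnc

variable (n a L c : ℕ) (J : Finset ℕ)

/-- The logical qubits of the threshold circuit. -/
abbrev Qubit : Type := Fin n ⊕ Unit ⊕ ThresholdAnc a L J

variable {n a L J} in
/-- The ancillary qubits among the logical qubits. -/
abbrev anc (q : ThresholdAnc a L J) : Qubit n a L J := Sum.inr (Sum.inr q)

/-- The input qubits. -/
def inputs : Finset (Qubit n a L J) := Finset.univ.image Sum.inl

/-- The digits of `|x| + c`, where `digit k g` is only meaningful if the lower digits are those of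
`g`. -/
noncomputable def digitStage : Stage (Qubit n a L J) where
  targets := (Finset.univ : Finset (Σ k : Fin a, Fin (2 ^ k.val))).toList.map
    fun p => anc (digit p.1 p.2)
  src _ := inputs n a L J
  weight t _ := match t with
    | Sum.inr (Sum.inr (digit k _)) => 1 / 2 ^ k.val
    | _ => 0
  const t := match t with
    | Sum.inr (Sum.inr (digit k g)) => ((c : ℝ) - g) / 2 ^ k.val
    | _ => 0

variable {n a L J} in
/-- The qubit that holds the digit `k` of `|x| + c` if the lower digits are those of `s`. -/
def digitOf (s : ℕ) (k : Fin a) : Qubit n a L J :=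
  anc (digit k ⟨s % 2 ^ k.val, Nat.mod_lt _ (by positivity)⟩)

/-- Parities of the positions at which the digits of `s` differ from those of `|x| + c`. -/
noncomputable def mismatchStage : Stage (Qubit n a L J) where
  targets := (Finset.univ : Finset (Fin (2 ^ a) × Finset (Fin a))).toList.map
    fun p => anc (mismatch p.1 p.2)
  src t := match t with
    | Sum.inr (Sum.inr (mismatch s S)) => S.image (digitOf s)
    | _ => ∅
  weight _ _ := 1
  const t := match t with
    | Sum.inr (Sum.inr (mismatch s S)) => ∑ k ∈ S, if s.val.testBit k then 1 else 0
    | _ => 0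

/-- The indicators of the residue of `|x| + c` modulo `2 ^ a`. -/
noncomputable def residueStage : Stage (Qubit n a L J) where
  targets := (Finset.univ : Finset (Fin (2 ^ a))).toList.map fun s => anc (residue s)
  src t := match t with
    | Sum.inr (Sum.inr (residue s)) => Finset.univ.image fun S => anc (mismatch s S)
    | _ => ∅
  weight _ _ := -(2 / 2 ^ a)
  const _ := 1

/-- For every `j` a family of qubits that are all `0` if and only if `(|x| + c) / 2 ^ a = j`. -/
noncomputable def quotientStage : Stage (Qubit n a L J) where
  targets := (Finset.univ : Finset (J × Fin L)).toList.map fun p => anc (quotient p.1 p.2)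
  src _ := inputs n a L J ∪ Finset.univ.image fun s => anc (residue s)
  weight t i := match t, i with
    | Sum.inr (Sum.inr (quotient _ k)), Sum.inl _ => 1 / (2 ^ a * 2 ^ k.val)
    | Sum.inr (Sum.inr (quotient _ k)), Sum.inr (Sum.inr (residue s)) =>
      -s.val / (2 ^ a * 2 ^ k.val)
    | _, _ => 0
  const t := match t with
    | Sum.inr (Sum.inr (quotient j k)) => ((c : ℝ) - j * 2 ^ a) / (2 ^ a * 2 ^ k.val)
    | _ => 0

/-- The parities of the subfamilies of the qubits computed by `quotientStage`. -/
noncomputable def parityStage : Stage (Qubit n a L J) where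
  targets := (Finset.univ : Finset (J × Finset (Fin L))).toList.map fun p => anc (parity p.1 p.2)
  src t := match t with
    | Sum.inr (Sum.inr (parity j S)) => S.image fun k => anc (quotient j k)
    | _ => ∅
  weight _ _ := 1
  const _ := 0

/-- The output is flipped if `(|x| + c) / 2 ^ a ∈ J`, and once more if `neg` is set. -/
noncomputable def outputStage (neg : Bool) : Stage (Qubit n a L J) where
  targets := [Sum.inr (Sum.inl ())]
  src _ := Finset.univ.image fun p : J × Finset (Fin L) => anc (parity p.1 p.2)
  weight _ _ := -(2 / 2 ^ L)
  const _ := J.card + if neg then 1 else 0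

/-- The stages before the output stage. -/
noncomputable def stages : List (Stage (Qubit n a L J)) :=
  [digitStage n a L c J, mismatchStage n a L J, residueStage n a L J, quotientStage n a L c J,
    parityStage n a L J]

theorem digitStage_WF : (digitStage n a L c J).WF := by
  refine ⟨(Finset.nodup_toList _).map fun p q h => ?_, ?_⟩
  · obtain ⟨k, g⟩ := p
    obtain ⟨k', g'⟩ := q
    simpa using h
  · simp [digitStage, inputs]

theorem mismatchStage_WF : (mismatchStage n a L J).WF := by
  refine ⟨(Finset.nodup_toList _).map fun p q h => ?_, ?_⟩
  · simpa [Prod.ext_iff] using h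
  · simp only [mismatchStage, List.mem_map]
    rintro _ ⟨p, -, rfl⟩ _ ⟨q, -, rfl⟩
    simp [digitOf]

theorem residueStage_WF : (residueStage n a L J).WF := by
  refine ⟨(Finset.nodup_toList _).map fun p q h => ?_, ?_⟩
  · simpa using h
  · simp [residueStage]

theorem quotientStage_WF : (quotientStage n a L c J).WF := by
  refine ⟨(Finset.nodup_toList _).map fun p q h => ?_, ?_⟩
  · simpa [Prod.ext_iff] using h
  · simp only [quotientStage, List.mem_map]
    rintro _ ⟨p, -, rfl⟩ _ ⟨q, -, rfl⟩
    simp [inputs]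

theorem parityStage_WF : (parityStage n a L J).WF := by
  refine ⟨(Finset.nodup_toList _).map fun p q h => ?_, ?_⟩
  · simpa [Prod.ext_iff] using h
  · simp only [parityStage, List.mem_map]
    rintro _ ⟨p, -, rfl⟩ _ ⟨q, -, rfl⟩
    simp

theorem stages_WF : ∀ S ∈ stages n a L c J, S.WF := by
  simp [stages, digitStage_WF, mismatchStage_WF, residueStage_WF, quotientStage_WF,
    parityStage_WF]

theorem output_notMem_src :
    ∀ S ∈ stages n a L c J, ∀ t ∈ S.targets, Sum.inr (Sum.inl ()) ∉ S.src t := by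
  simp only [stages, List.forall_mem_cons, digitStage, mismatchStage, residueStage, quotientStage,
    parityStage, List.mem_map]
  refine ⟨?_, ?_, ?_, ?_, ?_, by simp⟩ <;> rintro _ ⟨p, -, rfl⟩ <;> simp [inputs, digitOf]

theorem card_inputs_le : (inputs n a L J).card ≤ n :=
  Finset.card_image_le.trans (by simp)

theorem sum_two_pow_le (a : ℕ) : ∑ k : Fin a, 2 ^ k.val ≤ 2 ^ a := by
  rw [Fin.sum_univ_eq_sum_range fun k => 2 ^ k, Nat.geomSum_eq le_rfl]
  simp

theorem cost_digitStage_le : (digitStage n a L c J).cost ≤ 2 ^ a * (10 * n + 3) := by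
  refine (Stage.cost_le (B := n) fun t _ => card_inputs_le n a L J).trans ?_
  gcongr
  simpa [digitStage] using sum_two_pow_le a

theorem cost_mismatchStage_le :
    (mismatchStage n a L J).cost ≤ 2 ^ a * 2 ^ a * (10 * a + 3) := by
  refine (Stage.cost_le (B := a) fun t ht => ?_).trans ?_
  · simp only [mismatchStage, List.mem_map] at ht
    obtain ⟨p, -, rfl⟩ := ht
    exact Finset.card_image_le.trans ((Finset.card_le_univ _).trans (by simp))
  · simp [mismatchStage]

theorem cost_residueStage_le :
    (residueStage n a L J).cost ≤ 2 ^ a * (10 * 2 ^ a + 3) := by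
  refine (Stage.cost_le (B := 2 ^ a) fun t ht => ?_).trans ?_
  · simp only [residueStage, List.mem_map] at ht
    obtain ⟨p, -, rfl⟩ := ht
    exact Finset.card_image_le.trans (by simp)
  · simp [residueStage]

theorem cost_quotientStage_le :
    (quotientStage n a L c J).cost ≤ J.card * L * (10 * (n + 2 ^ a) + 3) := by
  refine (Stage.cost_le (B := n + 2 ^ a) fun t _ => ?_).trans ?_
  · refine (Finset.card_union_le _ _).trans (Nat.add_le_add (card_inputs_le n a L J) ?_)
    exact Finset.card_image_le.trans (by simp)
  · simp [quotientStage]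

theorem cost_parityStage_le :
    (parityStage n a L J).cost ≤ J.card * 2 ^ L * (10 * L + 3) := by
  refine (Stage.cost_le (B := L) fun t ht => ?_).trans ?_
  · simp only [parityStage, List.mem_map] at ht
    obtain ⟨p, -, rfl⟩ := ht
    exact Finset.card_image_le.trans ((Finset.card_le_univ _).trans (by simp))
  · simp [parityStage]

theorem cost_outputStage_le (neg : Bool) :
    (outputStage n a L J neg).cost ≤ 10 * (J.card * 2 ^ L) + 3 := by
  refine (Stage.cost_le (B := J.card * 2 ^ L) fun t ht => ?_).trans ?_
  · exact Finset.card_image_le.trans (by simp)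
  · simp [outputStage]

variable {n a L c J}

theorem sum_inputs {y : Qubit n a L J → Bool} {x : Fin n → Bool} (hy : ∀ i, y (Sum.inl i) = x i)
    (f : Qubit n a L J → ℝ) (r : ℝ) (hf : ∀ i, f (Sum.inl i) = r) :
    ∑ i ∈ inputs n a L J, (if y i then f i else 0) = hammingWt x * r := by
  rw [inputs, Finset.sum_image (by simp [Set.InjOn])]
  simp only [hy, hf]
  rw [Finset.sum_ite, Finset.sum_const, Finset.sum_const_zero, add_zero, nsmul_eq_mul, hammingWt]

/-- If `s` agrees with `N` below position `k`, the digit qubit holds the digit of `N`. -/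
theorem digit_eq {x : Fin n → Bool} {y y' : Qubit n a L J → Bool}
    (h : (digitStage n a L c J).Step y y') (hx : ∀ i, y (Sum.inl i) = x i)
    (h0 : ∀ q, y (anc q) = false) {s : ℕ} {k : Fin a}
    (hs : (hammingWt x + c) % 2 ^ k.val = s % 2 ^ k.val) :
    y' (digitOf s k) = (hammingWt x + c).testBit k := by
  have hang : (digitStage n a L c J).angle (digitOf s k) y =
      ((hammingWt x + c) / 2 ^ k.val : ℕ) := by
    rw [Stage.angle]
    change ((c : ℝ) - (s % 2 ^ k.val : ℕ)) / 2 ^ k.val + ∑ i ∈ inputs n a L J,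
      (if y i then (fun _ => (1 : ℝ) / 2 ^ k.val) i else 0) = _
    rw [sum_inputs hx _ _ fun _ => rfl, ← hs]
    have := Nat.div_add_mod (hammingWt x + c) (2 ^ k.val)
    have h' : (2 : ℝ) ^ k.val * ((hammingWt x + c) / 2 ^ k.val : ℕ) +
      ((hammingWt x + c) % 2 ^ k.val : ℕ) = hammingWt x + c := by exact_mod_cast this
    have hk : (2 : ℝ) ^ k.val ≠ 0 := by positivity
    field_simp
    linear_combination -h'
  rw [h.eq_xor _ hang, digitOf, h0, Bool.false_xor, Nat.testBit_eq_decide_div_mod_eq]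
  simp [digitStage, digitOf]

theorem mismatch_eq {y y' : Qubit n a L J → Bool} (h : (mismatchStage n a L J).Step y y')
    {s : Fin (2 ^ a)} {S : Finset (Fin a)} (h0 : y (anc (mismatch s S)) = false) :
    y' (anc (mismatch s S)) = decide ((∑ k ∈ S,
      ((if s.val.testBit k then 1 else 0) + if y (digitOf s k) then 1 else 0)) % 2 = 1) := by
  rw [h.eq_xor (m := ∑ k ∈ S, ((if s.val.testBit k then 1 else 0) +
    if y (digitOf s k) then 1 else 0)), h0, Bool.false_xor]
  · simp [mismatchStage]
  · rw [Stage.angle]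
    change (∑ k ∈ S, if s.val.testBit k then (1 : ℝ) else 0) +
      ∑ i ∈ S.image (digitOf s.val), (if y i then 1 else 0) = _
    rw [Finset.sum_image, ← Finset.sum_add_distrib]
    · push_cast
      rfl
    · intro k _ k' _ hkk
      simp only [digitOf, Sum.inr.injEq, digit.injEq] at hkk
      exact hkk.1

theorem residue_eq {y y' : Qubit n a L J → Bool} (h : (residueStage n a L J).Step y y')
    {s : Fin (2 ^ a)} (h0 : y (anc (residue s)) = false) {m : Fin a → ℕ}
    (hm : ∀ S, y (anc (mismatch s S)) = decide ((∑ k ∈ S, m k) % 2 = 1)) :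
    y' (anc (residue s)) = decide (∀ k, m k % 2 ≠ 1) := by
  have hang : (residueStage n a L J).angle (anc (residue s)) y =
      ((if ∀ k, m k % 2 ≠ 1 then 1 else 0 : ℕ) : ℝ) := by
    rw [Stage.angle]
    change (1 : ℝ) + ∑ i ∈ Finset.univ.image fun S => anc (mismatch s S),
      (if y i then -(2 / 2 ^ a) else 0) = _
    rw [Finset.sum_image (by simp [Set.InjOn])]
    have := sum_parity_eq_or m (fun S => y (anc (mismatch s S))) hm
    have h2 : ∀ S, (if y (anc (mismatch s S)) then -(2 / 2 ^ a : ℝ) else 0) =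
      -(2 / 2 ^ a * if y (anc (mismatch s S)) then (1 : ℝ) else 0) := fun S => by
        split_ifs <;> simp
    rw [Finset.sum_congr rfl fun S _ => h2 S, Finset.sum_neg_distrib, ← Finset.mul_sum, this]
    by_cases hk : ∃ k, m k % 2 = 1
    · rw [if_pos hk, if_neg (by push Not; exact hk)]; simp
    · rw [if_neg hk, if_pos (by push Not at hk; exact hk)]; simp
  rw [h.eq_xor _ hang, h0, Bool.false_xor]
  · by_cases hk : ∀ k, m k % 2 ≠ 1
    · rw [if_pos hk, decide_eq_true hk]; rfl
    · rw [if_neg hk, decide_eq_false hk]; rfl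
  · simp [residueStage]

theorem quotient_angle {x : Fin n → Bool} {y : Qubit n a L J → Bool}
    (hx : ∀ i, y (Sum.inl i) = x i)
    (hr : ∀ s, y (anc (residue s)) = decide (s.val = (hammingWt x + c) % 2 ^ a)) (j : J)
    (k : Fin L) : (quotientStage n a L c J).angle (anc (quotient j k)) y =
      (((hammingWt x + c) / 2 ^ a : ℕ) - (j : ℕ) : ℝ) / 2 ^ k.val := by
  have hd : Disjoint (inputs n a L J) (Finset.univ.image fun s => anc (residue s)) := by
    rw [Finset.disjoint_left]
    simp [inputs]
  have hlt : (hammingWt x + c) % 2 ^ a < 2 ^ a := Nat.mod_lt _ (by positivity)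
  have hsum : ∑ i ∈ Finset.univ.image fun s => (anc (residue s) : Qubit n a L J),
      (if y i then (quotientStage n a L c J).weight (anc (quotient j k)) i else 0) =
      -((hammingWt x + c) % 2 ^ a : ℕ) / (2 ^ a * 2 ^ k.val) := by
    rw [Finset.sum_image (by simp [Set.InjOn]), Finset.sum_eq_single ⟨_, hlt⟩]
    · rw [hr, if_pos (by simp)]
      rfl
    · intro s _ hs
      rw [hr, if_neg]
      simpa [Fin.ext_iff] using hs
    · simp
  rw [Stage.angle]
  change ((c : ℝ) - (j : ℕ) * 2 ^ a) / (2 ^ a * 2 ^ k.val) + ∑ i ∈ inputs n a L J ∪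
    Finset.univ.image fun s => anc (residue s), (if y i then
      (quotientStage n a L c J).weight (anc (quotient j k)) i else 0) = _
  rw [Finset.sum_union hd, hsum, sum_inputs hx _ (1 / (2 ^ a * 2 ^ k.val)) fun _ => rfl]
  have := Nat.div_add_mod (hammingWt x + c) (2 ^ a)
  have h' : (2 : ℝ) ^ a * ((hammingWt x + c) / 2 ^ a : ℕ) +
    ((hammingWt x + c) % 2 ^ a : ℕ) = hammingWt x + c := by exact_mod_cast this
  have hk : (2 : ℝ) ^ k.val ≠ 0 := by positivity
  have ha : (2 : ℝ) ^ a ≠ 0 := by positivity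
  field_simp
  linear_combination -h'

theorem exists_odd_quotient {D : ℤ} (hD : D ≠ 0) (hL : D.natAbs < 2 ^ L) :
    ∃ (k : Fin L) (m : ℤ), D = 2 ^ k.val * (2 * m + 1) := by
  obtain ⟨k, m, hm, h⟩ := Nat.exists_eq_two_pow_mul_odd (Int.natAbs_ne_zero.2 hD)
  have hk : k < L := by
    refine (Nat.pow_lt_pow_iff_right (a := 2) (by norm_num)).1 (lt_of_le_of_lt ?_ hL)
    rw [h]
    exact Nat.le_mul_of_pos_right _ hm.pos
  obtain ⟨m', rfl⟩ := hm
  rcases Int.natAbs_eq D with h' | h'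
  · exact ⟨⟨k, hk⟩, m', by rw [h', h]; push_cast; ring⟩
  · exact ⟨⟨k, hk⟩, -m' - 1, by rw [h', h]; push_cast; ring⟩

theorem exists_quotient_iff {x : Fin n → Bool} {y y' : Qubit n a L J → Bool}
    (h : (quotientStage n a L c J).Step y y') (hx : ∀ i, y (Sum.inl i) = x i)
    (hr : ∀ s, y (anc (residue s)) = decide (s.val = (hammingWt x + c) % 2 ^ a))
    (h0 : ∀ j k, y (anc (quotient j k)) = false) (hlt : hammingWt x + c < 2 ^ (a + L))
    (hJ : ∀ j ∈ J, j < 2 ^ L) (j : J) :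
    (∃ k, y' (anc (quotient j k)) = true) ↔ (hammingWt x + c) / 2 ^ a ≠ j := by
  have hmem : ∀ k, anc (quotient j k) ∈ (quotientStage n a L c J).targets := by
    simp [quotientStage]
  constructor
  · rintro ⟨k, hk⟩ heq
    have := h.eq_xor (hmem k) (m := 0) (by rw [quotient_angle hx hr, heq]; simp)
    rw [this, h0] at hk
    simp at hk
  · intro hne
    have hq : (hammingWt x + c) / 2 ^ a < 2 ^ L := by
      rw [Nat.div_lt_iff_lt_mul (by positivity), ← pow_add, add_comm L]
      exact hlt
    have hj := hJ j j.2
    generalize hN : (hammingWt x + c) / 2 ^ a = N at hne hq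
    obtain ⟨k, m, hm⟩ := exists_odd_quotient (L := L)
      (D := (N : ℤ) - (j : ℕ)) (by omega) (by omega)
    refine ⟨k, ?_⟩
    have hang : (quotientStage n a L c J).angle (anc (quotient j k)) y = 2 * (m : ℝ) + 1 := by
      rw [quotient_angle hx hr, hN, div_eq_iff (by positivity), mul_comm]
      exact_mod_cast hm
    have := h.2 _ (hmem k)
    rw [hang, phase_int_odd, h0] at this
    exact (this.resolve_left fun h' => h'.2 rfl).1

theorem parity_eq {y y' : Qubit n a L J → Bool} (h : (parityStage n a L J).Step y y')
    {j : J} {S : Finset (Fin L)} (h0 : y (anc (parity j S)) = false) :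
    y' (anc (parity j S)) =
      decide ((∑ k ∈ S, if y (anc (quotient j k)) then 1 else 0) % 2 = 1) := by
  rw [h.eq_xor (m := ∑ k ∈ S, if y (anc (quotient j k)) then 1 else 0), h0, Bool.false_xor]
  · simp [parityStage]
  · rw [Stage.angle]
    change (0 : ℝ) + ∑ i ∈ S.image fun k => anc (quotient j k), (if y i then 1 else 0) = _
    rw [Finset.sum_image (by simp [Set.InjOn]), zero_add]
    push_cast
    rfl

theorem output_angle {y : Qubit n a L J → Bool} {N : ℕ} {m : J → Fin L → ℕ} (neg : Bool)
    (hp : ∀ j S, y (anc (parity j S)) = decide ((∑ k ∈ S, m j k) % 2 = 1))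
    (hm : ∀ j : J, (∃ k, m j k % 2 = 1) ↔ N ≠ j) :
    (outputStage n a L J neg).angle (Sum.inr (Sum.inl ())) y =
      (((if N ∈ J then 1 else 0) + if neg then 1 else 0 : ℕ) : ℝ) := by
  rw [Stage.angle]
  change ((J.card : ℝ) + if neg then 1 else 0) +
    ∑ i ∈ Finset.univ.image fun p : J × Finset (Fin L) => anc (parity p.1 p.2),
      (if y i then -(2 / 2 ^ L) else 0) = _
  have hinj : Set.InjOn (fun p : J × Finset (Fin L) => (anc (parity p.1 p.2) : Qubit n a L J))
      (Finset.univ : Finset (J × Finset (Fin L))) := by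
    rintro ⟨j, S⟩ _ ⟨j', S'⟩ _ h
    simpa using h
  have h1 : ∀ j : J, ∑ S, (if y (anc (parity j S)) then -(2 / 2 ^ L : ℝ) else 0) =
      -1 + if N = j then 1 else 0 := by
    intro j
    have := sum_parity_eq_or (m j) (fun S => y (anc (parity j S))) (hp j)
    have h2 : ∀ S, (if y (anc (parity j S)) then -(2 / 2 ^ L : ℝ) else 0) =
      -(2 / 2 ^ L * if y (anc (parity j S)) then (1 : ℝ) else 0) := fun S => by
        split_ifs <;> simp
    rw [Finset.sum_congr rfl fun S _ => h2 S, Finset.sum_neg_distrib, ← Finset.mul_sum, this]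
    by_cases hN : N = j
    · rw [if_neg (by rw [hm]; simpa using hN), if_pos hN]; simp
    · rw [if_pos ((hm j).2 hN), if_neg hN]; simp
  rw [Finset.sum_image hinj, ← Finset.univ_product_univ, Finset.sum_product,
    Finset.sum_congr rfl fun j _ => h1 j, Finset.sum_add_distrib]
  have h3 : ∑ j : J, (if N = j then (1 : ℝ) else 0) = if N ∈ J then 1 else 0 := by
    rw [Finset.univ_eq_attach, Finset.sum_attach J fun j => if N = j then (1 : ℝ) else 0]
    simp
  rw [h3]
  simp only [Finset.sum_const, Finset.card_univ, Fintype.card_coe, nsmul_eq_mul]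
  push_cast
  ring

theorem forall_mismatch_even_iff {N : ℕ} {s : Fin (2 ^ a)} {d : Fin a → Bool}
    (hd : ∀ k : Fin a, N % 2 ^ k.val = s % 2 ^ k.val → d k = N.testBit k) :
    (∀ k : Fin a, ((if s.val.testBit k then 1 else 0) + if d k then 1 else 0) % 2 ≠ 1) ↔
      s.val = N % 2 ^ a := by
  have hpar : ∀ k : Fin a, ((if s.val.testBit k then 1 else 0) + if d k then 1 else 0) % 2 ≠ 1 ↔
      s.val.testBit k = d k := by
    intro k
    cases s.val.testBit k <;> cases d k <;> simp
  simp only [hpar]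
  constructor
  · intro h
    have key : ∀ k ≤ a, N % 2 ^ k = s % 2 ^ k := by
      intro k
      induction k with
      | zero => intro _; simp [Nat.mod_one]
      | succ k ih =>
        intro hk
        have ih := ih (by omega)
        have hb := (h ⟨k, hk⟩).trans (hd ⟨k, hk⟩ ih)
        simp only at hb
        have hb' : N / 2 ^ k % 2 = s / 2 ^ k % 2 := by
          simp only [Nat.testBit_eq_decide_div_mod_eq, decide_eq_decide] at hb
          omega
        rw [pow_succ, Nat.mod_mul, Nat.mod_mul, ih, hb']
    rw [key a le_rfl, Nat.mod_eq_of_lt s.2]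
  · intro h k
    have hk : N % 2 ^ k.val = s % 2 ^ k.val := by
      rw [h, Nat.mod_mod_of_dvd _ (pow_dvd_pow 2 k.2.le)]
    rw [hd k hk, h, Nat.testBit_mod_two_pow]
    simp

theorem phase_output {x : Fin n → Bool} {z : Bool} {y : Qubit n a L J → Bool} (neg : Bool)
    (hlt : hammingWt x + c < 2 ^ (a + L)) (hJ : ∀ j ∈ J, j < 2 ^ L)
    (h : Stage.Steps (stages n a L c J) (initialLabel _ x z) y) :
    phase ((outputStage n a L J neg).angle (Sum.inr (Sum.inl ())) y) =
      if xor neg (decide ((hammingWt x + c) / 2 ^ a ∈ J)) then -1 else 1 := by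
  obtain ⟨y₁, s1, y₂, s2, y₃, s3, y₄, s4, y₅, s5, rfl⟩ := h
  have hx1 : ∀ i, y₁ (Sum.inl i) = x i := fun i => s1.1 _ (by simp [digitStage])
  have hx2 : ∀ i, y₂ (Sum.inl i) = x i := fun i =>
    (s2.1 _ (by simp [mismatchStage])).trans (hx1 i)
  have hx3 : ∀ i, y₃ (Sum.inl i) = x i := fun i =>
    (s3.1 _ (by simp [residueStage])).trans (hx2 i)
  have hm0 : ∀ s S, y₁ (anc (mismatch s S)) = false := fun s S => s1.1 _ (by simp [digitStage])
  have hr0 : ∀ s, y₂ (anc (residue s)) = false := fun s =>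
    (s2.1 _ (by simp [mismatchStage])).trans (s1.1 _ (by simp [digitStage]))
  have hq0 : ∀ j k, y₃ (anc (quotient j k)) = false := fun j k =>
    (s3.1 _ (by simp [residueStage])).trans <|
      (s2.1 _ (by simp [mismatchStage])).trans (s1.1 _ (by simp [digitStage]))
  have hp0 : ∀ j S, y₄ (anc (parity j S)) = false := fun j S =>
    (s4.1 _ (by simp [quotientStage])).trans <| (s3.1 _ (by simp [residueStage])).trans <|
      (s2.1 _ (by simp [mismatchStage])).trans (s1.1 _ (by simp [digitStage]))
  have hr : ∀ s, y₃ (anc (residue s)) = decide (s.val = (hammingWt x + c) % 2 ^ a) := by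
    intro s
    rw [residue_eq s3 (hr0 s) fun S => mismatch_eq s2 (hm0 s S)]
    simp only [decide_eq_decide]
    exact forall_mismatch_even_iff fun k hk =>
      digit_eq s1 (fun _ => rfl) (fun _ => rfl) hk
  have hang := output_angle (N := (hammingWt x + c) / 2 ^ a) neg
    (fun j S => parity_eq s5 (hp0 j S)) fun j => by
      rw [← exists_quotient_iff s4 hx3 hr hq0 hlt hJ j]
      refine exists_congr fun k => ?_
      cases y₄ (anc (quotient j k)) <;> simp
  rw [hang, phase_natCast]
  by_cases hN : (hammingWt x + c) / 2 ^ a ∈ J <;> cases neg <;> simp [hN]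

theorem exists_circuit (neg : Bool) (hlt : n + c < 2 ^ (a + L)) (hJ : ∀ j ∈ J, j < 2 ^ L) :
    ∃ C : QCircuit n,
      C.Computes (fun x => xor neg (decide ((hammingWt x + c) / 2 ^ a ∈ J))) ∧ C.depth ≤ 99 ∧
      C.size ≤ 2 * (2 ^ a * (10 * n + 3) + 2 ^ a * 2 ^ a * (10 * a + 3) +
        2 ^ a * (10 * 2 ^ a + 3) + J.card * L * (10 * (n + 2 ^ a) + 3) +
        J.card * 2 ^ L * (10 * L + 3)) + (10 * (J.card * 2 ^ L) + 3) := by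
  obtain ⟨C, h1, h2, h3⟩ := exists_circuit_of_stages (F := outputStage n a L J neg)
    (stages_WF n a L c J) (output_notMem_src n a L c J) rfl (by simp [outputStage])
    fun x z y hy => phase_output neg (lt_of_le_of_lt (Nat.add_le_add_right
      ((Finset.card_le_univ _).trans (by simp)) c) hlt) hJ hy
  refine ⟨C, h1, h2, h3.trans ?_⟩
  have e1 := cost_digitStage_le n a L c J
  have e2 := cost_mismatchStage_le n a L J
  have e3 := cost_residueStage_le n a L J
  have e4 := cost_quotientStage_le n a L c J
  have e5 := cost_parityStage_le n a L J
  have e6 := cost_outputStage_le n a L J neg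
  simp only [stages, List.map_cons, List.map_nil, List.sum_cons, List.sum_nil]
  omega

end ThresholdCircuit

namespace ThresholdCircuit

theorem hammingWt_le {n : ℕ} (x : Fin n → Bool) : hammingWt x ≤ n :=
  (Finset.card_le_univ _).trans (by simp)

theorem exists_lt_dvd_add (t : ℕ) {M : ℕ} (hM : 0 < M) : ∃ c q, c < M ∧ t + c = q * M := by
  by_cases h : t % M = 0
  · exact ⟨0, t / M, hM, by rw [add_zero, Nat.div_mul_cancel (Nat.dvd_of_mod_eq_zero h)]⟩
  · have h1 := Nat.mod_lt t hM
    have h2 := Nat.div_add_mod t M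
    exact ⟨M - t % M, t / M + 1, by omega, by rw [add_mul, mul_comm (t / M)]; omega⟩

theorem pow_three_le (l : ℕ) : l ^ 3 ≤ 4 * 2 ^ l := by
  rcases lt_or_ge l 4 with h | h
  · interval_cases l <;> norm_num
  · induction l, h using Nat.le_induction with
    | base => norm_num
    | succ l hl ih =>
      have : (l + 1) ^ 3 ≤ 2 * l ^ 3 := by nlinarith [mul_le_mul hl hl (by norm_num) (by omega)]
      rw [pow_succ 2]
      omega

/-- The two ways of expressing the threshold function by the blocks of length `M` into which the
shifted Hamming weight falls: from below with about `t / M` blocks, from above with about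
`(n - t) / M` blocks. -/
theorem exists_blocks {n t τ M : ℕ} (hM : 0 < M) (htn : t ≤ n) (hτ : t ≤ τ ∨ n - t ≤ τ) :
    ∃ (c : ℕ) (J : Finset ℕ) (neg : Bool), c < M ∧ J.card * M ≤ τ + M ∧
      (∀ j ∈ J, j * M ≤ n + c) ∧
      (fun x : Fin n → Bool => xor neg (decide ((hammingWt x + c) / M ∈ J))) =
        thresholdFn n t := by
  obtain ⟨c, q, hc, hq⟩ := exists_lt_dvd_add t hM
  rcases hτ with hτ | hτ
  · refine ⟨c, Finset.range q, true, hc, by rw [Finset.card_range]; omega, fun j hj => ?_, ?_⟩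
    · have : j * M ≤ q * M := Nat.mul_le_mul_right _ (Finset.mem_range.1 hj).le
      omega
    · funext x
      rw [Bool.true_xor, thresholdFn, ← decide_not, decide_eq_decide, Finset.mem_range,
        Nat.div_lt_iff_lt_mul hM]
      omega
  · have hdiv := Nat.div_mul_le_self (n + c) M
    refine ⟨c, Finset.Ico q ((n + c) / M + 1), false, hc, ?_, fun j hj => ?_, ?_⟩
    · rw [Nat.card_Ico, Nat.sub_mul, add_mul]
      omega
    · rw [Finset.mem_Ico] at hj
      exact (Nat.mul_le_mul_right _ (Nat.lt_succ_iff.1 hj.2)).trans hdiv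
    · funext x
      have := hammingWt_le x
      have h1 : (hammingWt x + c) / M < (n + c) / M + 1 :=
        Nat.lt_succ_iff.2 (Nat.div_le_div_right (by omega))
      rw [Bool.false_xor, thresholdFn, decide_eq_decide, Finset.mem_Ico, and_iff_left h1,
        Nat.le_div_iff_mul_le hM]
      omega

theorem size_bound {n a l L M J P : ℕ} (hl : 1 ≤ l) (hM1 : 1 ≤ M) (hMn : M ≤ n)
    (haM : a * M ≤ 2 * n) (hL : L ≤ l + 2) (hJ : J * l ≤ 4 * M + l) (hP : 2 ^ L ≤ P)
    (hPn : P ≤ 4 * n) :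
    2 * (M * (10 * n + 3) + M * M * (10 * a + 3) + M * (10 * M + 3) + J * L * (10 * (n + M) + 3) +
      J * 2 ^ L * (10 * L + 3)) + (10 * (J * 2 ^ L) + 3) ≤ n * (1869 * M + 442 * l) := by
  have hn : 1 ≤ n := hM1.trans hMn
  have hL3 : L ≤ 3 * l := by omega
  have hL2 : 2 ^ L ≤ 4 * n := hP.trans hPn
  have hJl : J ≤ J * l := Nat.le_mul_of_pos_right _ hl
  have e1 : M * (10 * n + 3) ≤ 13 * (n * M) := by
    calc M * (10 * n + 3) ≤ M * (13 * n) := Nat.mul_le_mul_left _ (by omega)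
      _ = _ := by ring
  have e2 : M * M * (10 * a + 3) ≤ 23 * (n * M) := by
    calc M * M * (10 * a + 3) = M * (10 * (a * M) + 3 * M) := by ring
      _ ≤ M * (23 * n) := Nat.mul_le_mul_left _ (by omega)
      _ = _ := by ring
  have e3 : M * (10 * M + 3) ≤ 13 * (n * M) := by
    calc M * (10 * M + 3) ≤ M * (13 * n) := Nat.mul_le_mul_left _ (by omega)
      _ = _ := by ring
  have e4 : J * L * (10 * (n + M) + 3) ≤ 69 * (n * (J * l)) := by
    calc J * L * (10 * (n + M) + 3) ≤ J * (3 * l) * (23 * n) := by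
          gcongr
          omega
      _ = _ := by ring
  have e5 : J * 2 ^ L * (10 * L + 3) ≤ 132 * (n * (J * l)) := by
    calc J * 2 ^ L * (10 * L + 3) ≤ J * (4 * n) * (33 * l) := by
          gcongr
          omega
      _ = _ := by ring
  have e6 : J * 2 ^ L ≤ 4 * (n * (J * l)) := by
    calc J * 2 ^ L ≤ (J * l) * (4 * n) := Nat.mul_le_mul hJl hL2
      _ = _ := by ring
  have e7 : 1 ≤ n * M := Nat.mul_pos hn hM1
  have e8 : n * (J * l) ≤ n * (4 * M + l) := Nat.mul_le_mul_left _ hJ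
  have e9 : n * (4 * M + l) = 4 * (n * M) + n * l := by ring
  have e10 : n * (1869 * M + 442 * l) = 1869 * (n * M) + 442 * (n * l) := by ring
  omega

theorem exists_threshold_circuit {n t τ : ℕ} (hn : 2 ≤ n) (htn : t ≤ n) (hlτ : Nat.log 2 n ≤ τ)
    (hτn : τ ≤ n) (hτ : t ≤ τ ∨ n - t ≤ τ) :
    ∃ C : QCircuit n, C.Computes (thresholdFn n t) ∧ C.depth ≤ 99 ∧
      (C.size : ℝ) ≤ 2311 * (n * √(τ * Nat.log 2 n)) := by
  set l := Nat.log 2 n with hl_def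
  have hl : 1 ≤ l := Nat.log_pos (by norm_num) hn
  have hln : 2 ^ l ≤ n := Nat.pow_log_le_self 2 (by omega)
  have hnl : n < 2 ^ (l + 1) := Nat.lt_pow_succ_log_self (by norm_num) n
  have hP : τ * l ≠ 0 := (Nat.mul_pos (hl.trans hlτ) hl).ne'
  set a := Nat.log 4 (τ * l) with ha_def
  have ha1 : 2 ^ a * 2 ^ a ≤ τ * l := by
    rw [← mul_pow]
    exact Nat.pow_log_le_self 4 hP
  have ha2 : τ * l < 4 * (2 ^ a * 2 ^ a) := by
    rw [← mul_pow, mul_comm 4]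
    exact Nat.lt_pow_succ_log_self (b := 4) (by norm_num) _
  have hM1 : 1 ≤ 2 ^ a := Nat.one_le_two_pow
  have hMnl : 2 ^ a * 2 ^ a ≤ n * l := ha1.trans (Nat.mul_le_mul_right _ hτn)
  have hMn : 2 ^ a ≤ n := Nat.mul_self_le_mul_self_iff.1
    (hMnl.trans (Nat.mul_le_mul_left _ (hlτ.trans hτn)))
  have hal : a ≤ l := Nat.le_log_of_pow_le (by norm_num) hMn
  have haM : a * 2 ^ a ≤ 2 * n := by
    refine Nat.mul_self_le_mul_self_iff.1 ?_
    calc a * 2 ^ a * (a * 2 ^ a) = a * a * (2 ^ a * 2 ^ a) := by ring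
      _ ≤ l * l * (n * l) := Nat.mul_le_mul (Nat.mul_le_mul hal hal) hMnl
      _ = l ^ 3 * n := by ring
      _ ≤ 4 * n * n := Nat.mul_le_mul_right _ ((pow_three_le l).trans (by omega))
      _ = _ := by ring
  obtain ⟨c, J, neg, hc, hJ, hJn, hf⟩ := exists_blocks (M := 2 ^ a) hM1 htn hτ
  have haL : a + (l + 2 - a) = l + 2 := by omega
  have hnc : n + c < 2 ^ (a + (l + 2 - a)) := by
    rw [haL, pow_succ]
    omega
  obtain ⟨C, h1, h2, h3⟩ := exists_circuit (L := l + 2 - a) (J := J) neg hnc fun j hj => by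
    have := (hJn j hj).trans_lt hnc
    rw [pow_add, mul_comm (2 ^ a)] at this
    exact lt_of_mul_lt_mul_right this (Nat.zero_le _)
  rw [hf] at h1
  have hJl : J.card * l ≤ 4 * 2 ^ a + l := by
    refine Nat.le_of_mul_le_mul_right ?_ hM1
    calc J.card * l * 2 ^ a = J.card * 2 ^ a * l := by ring
      _ ≤ (τ + 2 ^ a) * l := Nat.mul_le_mul_right _ hJ
      _ = τ * l + 2 ^ a * l := by ring
      _ ≤ 4 * (2 ^ a * 2 ^ a) + 2 ^ a * l := by omega
      _ = _ := by ring
  have hsize := h3.trans (size_bound (P := 2 ^ (l + 2)) hl hM1 hMn haM (Nat.sub_le _ _) hJl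
    (Nat.pow_le_pow_right (by norm_num) (Nat.sub_le _ _)) (by rw [pow_add]; omega))
  refine ⟨C, h1, h2, ?_⟩
  have r1 : ((2 ^ a : ℕ) : ℝ) ≤ √(τ * l) := by
    apply Real.le_sqrt_of_sq_le
    rw [sq]
    exact_mod_cast ha1
  have r2 : (l : ℝ) ≤ √(τ * l) := by
    apply Real.le_sqrt_of_sq_le
    rw [sq]
    exact_mod_cast Nat.mul_le_mul_right l hlτ
  have r3 : (C.size : ℝ) ≤ n * (1869 * (2 ^ a : ℕ) + 442 * l) := by exact_mod_cast hsize
  calc (C.size : ℝ) ≤ n * (1869 * (2 ^ a : ℕ) + 442 * l) := r3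
    _ ≤ n * (1869 * √(τ * l) + 442 * √(τ * l)) := by gcongr
    _ = _ := by ring

end ThresholdCircuit

theorem theorem2 :
    ∃ (D : ℕ) (K : ℝ), ∀ n t : ℕ, 2 ≤ n → 1 ≤ t → t ≤ n →
      (((t : ℝ) ≤ Real.logb 2 n ∨ (n : ℝ) - Real.logb 2 n ≤ t) →
        ∃ C : QCircuit n, C.Computes (thresholdFn n t) ∧ C.depth ≤ D ∧
          (C.size : ℝ) ≤ K * (n * Real.logb 2 n)) ∧
      ((Real.logb 2 n ≤ t ∧ t ≤ ⌈(n : ℝ) / 2⌉₊) →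
        ∃ C : QCircuit n, C.Computes (thresholdFn n t) ∧ C.depth ≤ D ∧
          (C.size : ℝ) ≤ K * (n * √(t * Real.logb 2 n))) ∧
      ((⌈(n : ℝ) / 2⌉₊ ≤ t ∧ (t : ℝ) ≤ n - Real.logb 2 n) →
        ∃ C : QCircuit n, C.Computes (thresholdFn n t) ∧ C.depth ≤ D ∧
          (C.size : ℝ) ≤ K * (n * √(((n : ℝ) - t) * Real.logb 2 n))) := by
  refine ⟨99, 2311, fun n t hn _ htn => ?_⟩
  have hfloor : ∀ s : ℕ, (s : ℝ) ≤ Real.logb 2 n → s ≤ Nat.log 2 n := fun s hs => by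
    rw [← Real.natFloor_logb_natCast]
    exact Nat.le_floor (by exact_mod_cast hs)
  have hlog : (Nat.log 2 n : ℝ) ≤ Real.logb 2 n := by exact_mod_cast Real.natLog_le_logb n 2
  have hsub : ((n - t : ℕ) : ℝ) = n - t := Nat.cast_sub htn
  refine ⟨fun h => ?_, fun h => ?_, fun h => ?_⟩
  · have hτ : t ≤ Nat.log 2 n ∨ n - t ≤ Nat.log 2 n :=
      h.imp (hfloor t) fun h => hfloor _ (by rw [hsub]; linarith)
    obtain ⟨C, h1, h2, h3⟩ := ThresholdCircuit.exists_threshold_circuit hn htn le_rfl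
      (Nat.log_le_self 2 n) hτ
    refine ⟨C, h1, h2, h3.trans ?_⟩
    rw [Real.sqrt_mul_self (Nat.cast_nonneg _)]
    gcongr
  · obtain ⟨C, h1, h2, h3⟩ := ThresholdCircuit.exists_threshold_circuit hn htn
      (τ := t) (by exact_mod_cast hlog.trans h.1) htn (Or.inl le_rfl)
    refine ⟨C, h1, h2, h3.trans ?_⟩
    gcongr
  · obtain ⟨C, h1, h2, h3⟩ := ThresholdCircuit.exists_threshold_circuit hn htn (τ := n - t)
      (by
        have : (Nat.log 2 n : ℝ) ≤ (n - t : ℕ) := by rw [hsub]; linarith [h.2]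
        exact_mod_cast this)
      (Nat.sub_le _ _) (Or.inr le_rfl)
    refine ⟨C, h1, h2, h3.trans ?_⟩
    rw [hsub]
    have : (0 : ℝ) ≤ n - t := by rw [← hsub]; positivity
    gcongr
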